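/- Let $(M,\eta)$ be a contact manifold of dimension $2n+1$ (for instance $M=T^*Q\times\mathbb R$ with $\eta=dz-p_i\,dq^i$), with Reeb field $\mathcal R$, $\bar\flat(v)=i_vd\eta+\eta(v)\eta$, $\sharp=\bar\flat^{-1}$, bivector $\Lambda(\alpha,\beta)=-d\eta(\sharp\alpha,\sharp\beta)$, $\sharp_\Lambda(\alpha)=\Lambda(\alpha,\cdot)$, Jacobi bracket $\{f,g\}=\Lambda(df,dg)-f\mathcal R(g)+g\mathcal R(f)$, and Hamiltonian vector fields $X_f=\sharp(df-(\mathcal R(f)+f)\eta)$. Let $M_1\subseteq M$ be a submanifold on which $\eta$ induces a precontact form $\eta_1$ of class $2r+1$, let $H_1$ be a smooth function on $M_1$, and let $M_f\subseteq M_1$ be the final constraint submanifold of the precontact Hamiltonian system $(M_1,\eta_1,H_1)$, i.e. the set at which the algorithm $$M_{i+1}=\{p\in M_i \mid (dH_1-(H_1+\mathcal R_1(H_1))\eta_1)_p\in\bar\flat_1(T_pM_i)\}$$ stabilizes, where $\mathcal R_1$ is a Reeb vector field of $\eta_1$ and $\bar\flat_1(v)=i_vd\eta_1+\eta_1(v)\eta_1$.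 Let $U\subseteq M$ be open and let $\phi^a,\bar\phi^{\bar a}$ be finitely many smooth functions on $U$ whose common zero set is $M_f\cap U$ and whose differentials are linearly independent at the points of $M_f\cap U$. A smooth function on $U$ is called first class if its brackets with all these constraints vanish on $M_f\cap U$. Assume that every $\bar\phi^{\bar a}$ is first class and that $C^{ab}=\{\phi^a,\phi^b\}$ is an invertible matrix at every point of $U$, with inverse $C_{ab}$. Define, for smooth $f,g$ on $U$, $$\{f,g\}_{DJ}=\{f,g\}-\{f,\phi^a\}C_{ab}\{\phi^b,g\},\qquad \mathcal R_{DJ}=\mathcal R+C_{ab}\,\mathcal R(\phi^b)\,(\sharp_\Lambda(d\phi^a)-\phi^a\mathcal R).$$ Then: 1. $\{\cdot,\cdot\}_{DJ}$ is a Jacobi bracket on $C^\infty(U)$: it is a local Lie algebra bracket, and there is a bivector field $\Lambda_{DJ}$ on $U$ such that $(\Lambda_{DJ},E_{DJ})$, with $E_{DJ}=-\mathcal R_{DJ}$, is a Jacobi structure and $\{f,g\}_{DJ}=\Lambda_{DJ}(df,dg)+fE_{DJ}(g)-gE_{DJ}(f)$. It satisfies on $U$ the generalized Leibniz rule $\{fg,h\}_{DJ}=f\{g,h\}_{DJ}+g\{f,h\}_{DJ}+fg\,\mathcal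 R_{DJ}(h)$. 2. The second class constraints are Casimir functions: $\{\phi^a,g\}_{DJ}=0$ on $U$ for all $a$ and all $g\in C^\infty(U)$. 3. For every first class function $F$, on $M_f\cap U$ one has $\{F,g\}_{DJ}=\{F,g\}$ for all $g\in C^\infty(U)$, and $\mathcal R_{DJ}(F)=\mathcal R(F)$. 4. Let $H\in C^\infty(U)$ be an arbitrary extension of $H_1|_{M_1\cap U}$. Every vector field $X$ along $M_f\cap U$ that is tangent to $M_f$ and solves $\bar\flat_1(X)=dH_1-(H_1+\mathcal R_1(H_1))\eta_1$ can be written, along $M_f\cap U$, as $$X=X_H+u_aX_{\phi^a}+\bar u_{\bar a}X_{\bar\phi^{\bar a}}$$ for some multipliers $u_a,\bar u_{\bar a}$, which can be taken smooth on $M_f\cap U$ if $X$ is smooth. Moreover, at each point of $M_f\cap U$, for every vector $X$ of this form that is tangent to $M_f$, the second class multipliers are determined, $u_a=-\{H,\phi^b\}C_{ba}$, and the evolution $\dot f=X(f)$ of every observable $f\in C^\infty(U)$ is $$\dot f=\{H,f\}_{DJ}-f\,\mathcal R_{DJ}(H)+\bar u_{\bar a}\bigl(\{\bar\phi^{\bar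 a},f\}_{DJ}-f\,\mathcal R_{DJ}(\bar\phi^{\bar a})\bigr),$$ so that it depends only on the multipliers $\bar u_{\bar a}$ of the first class constraints; if $H$ is first class, then $X=X_H+\bar u_{\bar a}X_{\bar\phi^{\bar a}}$. -/

import Mathlib

open scoped Manifold ContDiff Topology

noncomputable section

namespace DiracJacobi

section Contact

variable {E : Type*} [NormedAddCommGroup E] [NormedSpace ℝ E]
  {W : Type*} [TopologicalSpace W] (I : ModelWithCorners ℝ E W)
  {M : Type*} [TopologicalSpace M] [ChartedSpace W M]

/-- Smooth real-valued functions on the (open) subset `U` of `M`. -/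
def SmoothOn (U : Set M) (f : M → ℝ) : Prop := ContMDiffOn I 𝓘(ℝ, ℝ) ∞ f U

/-- Vector fields on `M`, or along a subset of `M`, smooth on the subset `S`. -/
def SmoothFieldOn [IsManifold I ∞ M] (S : Set M) (X : (p : M) → TangentSpace I p) : Prop :=
  ContMDiffOn I I.tangent ∞ (fun p => (⟨p, X p⟩ : TangentBundle I M)) S

/-- Smooth one-forms, as smooth sections of the cotangent bundle. -/
def IsSmoothForm [IsManifold I ∞ M] (η : (p : M) → TangentSpace I p →L[ℝ] ℝ) : Prop :=
  ContMDiff I (I.prod 𝓘(ℝ, E →L[ℝ] ℝ)) ∞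
    (fun p => Bundle.TotalSpace.mk' (E →L[ℝ] ℝ)
      (E := fun q : M => TangentSpace I q →L[ℝ] ℝ) p (η p))

/-- The expression of a one-form in the preferred chart at `p`: its pullback by the inverse
of that chart. -/
def formInChart (η : (p : M) → TangentSpace I p →L[ℝ] ℝ) (p : M) : E → E →L[ℝ] ℝ :=
  fun y => (η ((extChartAt I p).symm y)).comp
    (mfderiv 𝓘(ℝ, E) I (extChartAt I p).symm y : E →L[ℝ] TangentSpace I ((extChartAt I p).symm y))

/-- The exterior derivative `dη` of a one-form, computed in the preferred chart at `p`,
with the normalisation `dη(X, Y) = X(η(Y)) - Y(η(X)) - η([X, Y])`. -/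
def dForm (η : (p : M) → TangentSpace I p →L[ℝ] ℝ) (p : M) (v w : TangentSpace I p) : ℝ :=
  extDeriv
    (fun y => ContinuousAlternatingMap.ofSubsingleton ℝ E ℝ (0 : Fin 1) (formInChart I η p y))
    (extChartAt I p p)
    ![(mfderiv I 𝓘(ℝ, E) (extChartAt I p) p v : E), (mfderiv I 𝓘(ℝ, E) (extChartAt I p) p w : E)]

/-- Contact forms: `dim M = 2n + 1` and `ker η ∩ ker dη = 0` at every point,
i.e. `η ∧ (dη)^n` vanishes nowhere. -/
def IsContactForm [IsManifold I ∞ M] (η : (p : M) → TangentSpace I p →L[ℝ] ℝ) : Prop :=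
  IsSmoothForm I η ∧ (∃ n : ℕ, Module.finrank ℝ E = 2 * n + 1) ∧
    ∀ (p : M) (v : TangentSpace I p), η p v = 0 → (∀ w, dForm I η p v w = 0) → v = 0

/-- The Reeb vector field: `i_R dη = 0`, `η(R) = 1`. -/
def reeb (η : (p : M) → TangentSpace I p →L[ℝ] ℝ) (p : M) : TangentSpace I p :=
  Classical.epsilon fun v => η p v = 1 ∧ ∀ w, dForm I η p v w = 0

/-- The inverse `♯` of the isomorphism `♭(v) = i_v dη + η(v) η`. -/
def sharp (η : (p : M) → TangentSpace I p →L[ℝ] ℝ) (p : M) (α : TangentSpace I p →L[ℝ] ℝ) :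
    TangentSpace I p :=
  Classical.epsilon fun v => ∀ w, dForm I η p v w + η p v * η p w = α w

/-- The bivector `Λ(α, β) = - dη(♯α, ♯β)`. -/
def contactBivector (η : (p : M) → TangentSpace I p →L[ℝ] ℝ) (p : M)
    (α β : TangentSpace I p →L[ℝ] ℝ) : ℝ :=
  -dForm I η p (sharp I η p α) (sharp I η p β)

/-- `♯_Λ(α) = Λ(α, ·)`, as a tangent vector. -/
def sharpBivector (η : (p : M) → TangentSpace I p →L[ℝ] ℝ) (p : M)
    (α : TangentSpace I p →L[ℝ] ℝ) : TangentSpace I p :=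
  Classical.epsilon fun v => ∀ β : TangentSpace I p →L[ℝ] ℝ, β v = contactBivector I η p α β

/-- `R(f)`. -/
def reebDeriv (η : (p : M) → TangentSpace I p →L[ℝ] ℝ) (f : M → ℝ) (p : M) : ℝ :=
  mvfderiv I f p (reeb I η p)

/-- The Jacobi bracket of the contact manifold: `{f, g} = Λ(df, dg) + f E(g) - g E(f)`
with `E = -R`. -/
def bracket (η : (p : M) → TangentSpace I p →L[ℝ] ℝ) (f g : M → ℝ) (p : M) : ℝ :=
  contactBivector I η p (mvfderiv I f p) (mvfderiv I g p)
    - f p * reebDeriv I η g p + g p * reebDeriv I η f p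

/-- The Hamiltonian vector field: `♭(X_h) = dh - (R(h) + h) η`. -/
def hamField (η : (p : M) → TangentSpace I p →L[ℝ] ℝ) (h : M → ℝ) (p : M) : TangentSpace I p :=
  sharp I η p (mvfderiv I h p - (reebDeriv I η h p + h p) • η p)

end Contact

section Jacobi

variable {E : Type*} [NormedAddCommGroup E] [NormedSpace ℝ E]
  {W : Type*} [TopologicalSpace W] (I : ModelWithCorners ℝ E W)
  {M : Type*} [TopologicalSpace M] [ChartedSpace W M]

/-- A Jacobi structure `(Λ, E)` on the open set `U`: a smooth bivector field `Λ` and a smooth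
vector field `V = E` with `[Λ, Λ] = 2 E ∧ Λ` and `[E, Λ] = L_E Λ = 0`. Both identities between
multivector fields are evaluated on exact one-forms, where, for the Schouten-Nijenhuis bracket,
`[Λ, Λ](df, dg, dh) = 2 (Λ(d(Λ(df, dg)), dh) + cyclic)` and
`(E ∧ Λ)(df, dg, dh) = E(f) Λ(dg, dh) + cyclic`. -/
structure IsJacobiStructureOn [IsManifold I ∞ M] (U : Set M)
    (Λ : (p : M) → (TangentSpace I p →L[ℝ] ℝ) →ₗ[ℝ] (TangentSpace I p →L[ℝ] ℝ) →ₗ[ℝ] ℝ)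
    (V : (p : M) → TangentSpace I p) : Prop where
  skew : ∀ p ∈ U, ∀ α β, Λ p α β = -Λ p β α
  smooth_bivector : ∀ f g : M → ℝ, SmoothOn I U f → SmoothOn I U g →
    SmoothOn I U (fun p => Λ p (mvfderiv I f p) (mvfderiv I g p))
  smooth_field : SmoothFieldOn I U V
  schouten : ∀ f g h : M → ℝ, SmoothOn I U f → SmoothOn I U g → SmoothOn I U h → ∀ p ∈ U,
    2 * (Λ p (mvfderiv I (fun q => Λ q (mvfderiv I f q) (mvfderiv I g q)) p) (mvfderiv I h p)
      + Λ p (mvfderiv I (fun q => Λ q (mvfderiv I g q) (mvfderiv I h q)) p) (mvfderiv I f p)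
      + Λ p (mvfderiv I (fun q => Λ q (mvfderiv I h q) (mvfderiv I f q)) p) (mvfderiv I g p))
    = 2 * (mvfderiv I f p (V p) * Λ p (mvfderiv I g p) (mvfderiv I h p)
      + mvfderiv I g p (V p) * Λ p (mvfderiv I h p) (mvfderiv I f p)
      + mvfderiv I h p (V p) * Λ p (mvfderiv I f p) (mvfderiv I g p))
  lie_deriv : ∀ f g : M → ℝ, SmoothOn I U f → SmoothOn I U g → ∀ p ∈ U,
    mvfderiv I (fun q => Λ q (mvfderiv I f q) (mvfderiv I g q)) p (V p)
      - Λ p (mvfderiv I (fun q => mvfderiv I f q (V q)) p) (mvfderiv I g p)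
      - Λ p (mvfderiv I f p) (mvfderiv I (fun q => mvfderiv I g q (V q)) p) = 0

/-- `br` is a Jacobi bracket on the smooth functions on `U`, with vector field `V = E`: it is
the bracket `{f, g} = Λ(df, dg) + f E(g) - g E(f)` of a Jacobi structure `(Λ, E)` on `U`, and
it is a local Lie algebra bracket. -/
structure IsJacobiBracketOn [IsManifold I ∞ M] (U : Set M) (br : (M → ℝ) → (M → ℝ) → M → ℝ)
    (V : (p : M) → TangentSpace I p) : Prop where
  jacobi_structure : ∃ Λ : (p : M) → (TangentSpace I p →L[ℝ] ℝ) →ₗ[ℝ]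
      (TangentSpace I p →L[ℝ] ℝ) →ₗ[ℝ] ℝ,
    IsJacobiStructureOn I U Λ V ∧
    ∀ f g : M → ℝ, SmoothOn I U f → SmoothOn I U g → ∀ p ∈ U,
      br f g p = Λ p (mvfderiv I f p) (mvfderiv I g p)
        + f p * mvfderiv I g p (V p) - g p * mvfderiv I f p (V p)
  smooth : ∀ f g : M → ℝ, SmoothOn I U f → SmoothOn I U g → SmoothOn I U (br f g)
  add_left : ∀ f g h : M → ℝ, SmoothOn I U f → SmoothOn I U g → SmoothOn I U h → ∀ p ∈ U,
    br (f + g) h p = br f h p + br g h p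
  smul_left : ∀ (c : ℝ) (f g : M → ℝ), SmoothOn I U f → SmoothOn I U g → ∀ p ∈ U,
    br (c • f) g p = c * br f g p
  skew : ∀ f g : M → ℝ, SmoothOn I U f → SmoothOn I U g → ∀ p ∈ U, br f g p = -br g f p
  jacobi : ∀ f g h : M → ℝ, SmoothOn I U f → SmoothOn I U g → SmoothOn I U h → ∀ p ∈ U,
    br f (br g h) p + br g (br h f) p + br h (br f g) p = 0
  locality : ∀ f g : M → ℝ, SmoothOn I U f → SmoothOn I U g → ∀ p ∈ U,
    f =ᶠ[𝓝 p] 0 → br f g p = 0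

end Jacobi

section Constraints

variable {E : Type*} [NormedAddCommGroup E] [NormedSpace ℝ E]
  {W : Type*} [TopologicalSpace W] (I : ModelWithCorners ℝ E W)
  {M : Type*} [TopologicalSpace M] [ChartedSpace W M]

/-- (Embedded) submanifolds of codimension `k`: locally the zero set of `k` independent
smooth functions. -/
def IsSubmanifold (S : Set M) : Prop :=
  ∃ k : ℕ, ∀ p ∈ S, ∃ (U : Set M) (ψ : Fin k → M → ℝ), IsOpen U ∧ p ∈ U ∧
    (∀ i, SmoothOn I U (ψ i)) ∧ (∀ q ∈ U, q ∈ S ↔ ∀ i, ψ i q = 0) ∧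
    ∀ q ∈ S ∩ U, LinearIndependent ℝ (fun i => mvfderiv I (ψ i) q)

/-- The tangent space `T_p S`: the vectors that annihilate every smooth function
vanishing on `S` near `p`. -/
def tangentTo (S : Set M) (p : M) : Submodule ℝ (TangentSpace I p) :=
  ⨅ f ∈ {f : M → ℝ | ContMDiffAt I 𝓘(ℝ, ℝ) ∞ f p ∧ ∀ᶠ q in 𝓝[S] p, f q = 0},
    LinearMap.ker (mvfderiv I f p : TangentSpace I p →ₗ[ℝ] ℝ)

/-- The characteristic space `ker η₁ ∩ ker dη₁` at `p` of the pullback `η₁` of `η` to `S`. -/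
def charSpace (η : (p : M) → TangentSpace I p →L[ℝ] ℝ) (S : Set M) (p : M) :
    Set (TangentSpace I p) :=
  {v | v ∈ tangentTo I S p ∧ η p v = 0 ∧ ∀ w ∈ tangentTo I S p, dForm I η p v w = 0}

/-- The pullback of `η` to `S` is precontact: for some `r` it has class `2r + 1`, that is,
its characteristic distribution has rank `dim S - (2r + 1)`. -/
def IsPrecontactOn (η : (p : M) → TangentSpace I p →L[ℝ] ℝ) (S : Set M) : Prop :=
  ∃ r : ℕ, ∀ p ∈ S, Module.finrank ℝ (tangentTo I S p) =
    Module.finrank ℝ (Submodule.span ℝ (charSpace I η S p)) + (2 * r + 1)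

/-- `v` solves Hamilton's equation `♭₁(v) = dh₁ - (h₁ + R₁(h₁)) η₁` at `p` of the precontact
system `(S, η₁, h₁)`, where `η₁`, `h₁` are the restrictions of `η`, `h` to `S` and `R₁` is a
Reeb vector of `η₁`. The condition does not depend on the choice of `R₁`. -/
def SolvesHamilton (η : (p : M) → TangentSpace I p →L[ℝ] ℝ) (S : Set M) (h : M → ℝ)
    (p : M) (v : TangentSpace I p) : Prop :=
  v ∈ tangentTo I S p ∧ ∃ R₁ ∈ tangentTo I S p,
    η p R₁ = 1 ∧ (∀ w ∈ tangentTo I S p, dForm I η p R₁ w = 0) ∧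
    ∀ w ∈ tangentTo I S p, dForm I η p v w + η p v * η p w =
      mvfderiv I h p w - (h p + mvfderiv I h p R₁) * η p w

/-- The constraint algorithm on the precontact system `(S, η₁, h₁)`: it starts at `S`, and each
next set consists of the points of the previous one where Hamilton's equation on `S` has a
solution tangent to the previous one. -/
def constraintSet (η : (p : M) → TangentSpace I p →L[ℝ] ℝ) (S : Set M) (h : M → ℝ) :
    ℕ → Set M
  | 0 => S
  | i + 1 => {p | p ∈ constraintSet η S h i ∧
      ∃ v ∈ tangentTo I (constraintSet η S h i) p, SolvesHamilton I η S h p v}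

/-- `N` is the final constraint submanifold: the set at which the algorithm stabilises. -/
def IsFinalConstraint (η : (p : M) → TangentSpace I p →L[ℝ] ℝ) (S : Set M) (h : M → ℝ)
    (N : Set M) : Prop :=
  ∃ i : ℕ, N = constraintSet I η S h i ∧ constraintSet I η S h (i + 1) = N

/-- `f` is first class with respect to constraints `c` that define the set `N` on `U`:
its brackets with all the constraints vanish on `N ∩ U`. -/
def IsFirstClass (η : (p : M) → TangentSpace I p →L[ℝ] ℝ) {σ : Type*} (c : σ → M → ℝ)
    (N U : Set M) (f : M → ℝ) : Prop :=
  ∀ s, ∀ p ∈ N ∩ U, bracket I η f (c s) p = 0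

variable {ι : Type*} [Fintype ι] [DecidableEq ι]

/-- The matrix `C^{ab} = {φ^a, φ^b}`. -/
def bracketMatrix (η : (p : M) → TangentSpace I p →L[ℝ] ℝ) (φ : ι → M → ℝ) (p : M) :
    Matrix ι ι ℝ :=
  Matrix.of fun a b => bracket I η (φ a) (φ b) p

/-- The Dirac-Jacobi bracket `{f, g} - {f, φ^a} C_{ab} {φ^b, g}`. -/
def djBracket (η : (p : M) → TangentSpace I p →L[ℝ] ℝ) (φ : ι → M → ℝ) (f g : M → ℝ) (p : M) :
    ℝ :=
  bracket I η f g p - ∑ a, ∑ b,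
    bracket I η f (φ a) p * (bracketMatrix I η φ p)⁻¹ a b * bracket I η (φ b) g p

/-- The vector field `R_DJ = R + C_{ab} R(φ^b) (♯_Λ(dφ^a) - φ^a R)`. -/
def djReeb (η : (p : M) → TangentSpace I p →L[ℝ] ℝ) (φ : ι → M → ℝ) (p : M) :
    TangentSpace I p :=
  reeb I η p + ∑ a, ∑ b, ((bracketMatrix I η φ p)⁻¹ a b * reebDeriv I η (φ b) p) •
    (sharpBivector I η p (mvfderiv I (φ a) p) - φ a p • reeb I η p)

/-- `R_DJ(f)`. -/
def djReebDeriv (η : (p : M) → TangentSpace I p →L[ℝ] ℝ) (φ : ι → M → ℝ) (f : M → ℝ) (p : M) :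
    ℝ :=
  mvfderiv I f p (djReeb I η φ p)

end Constraints

end DiracJacobi

end

noncomputable section

namespace DiracJacobi

/-! ### Contact vector fields on an open subset of a normed space -/

section Coordinates

open VectorField

variable {E : Type*} [NormedAddCommGroup E] [NormedSpace ℝ E]

/-! The contact bracket. The field `X_f` is the unique field with `η(X_f) = -f` whose Lie derivative
multiplies `η` by a function, namely `-R(f)`. Fields that rescale `η` in this way are closed under
the Lie bracket, and the Hamiltonian of `[X_f, X_g]` is `{f, g} = X_f(g) + g R(f)`. By uniqueness
`[X_f, X_g]` is the field of `{f, g}`, so the operators `h ↦ X_f(h) + h R(f)` represent the bracket,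
which is the Jacobi identity (`IsContactFieldOn.jacobi`). This is done on open sets of the model
space and carried to `M` by charts, using that `d` commutes with transition maps (`dForm_eq_curl`).

The Dirac-Jacobi bracket. The second class constraints are Casimirs because `C C⁻¹ = 1`
(`djBracket_constraint`). Hence constant multiples of them may be added to a function without
changing any of its Dirac-Jacobi brackets, and since `C` is invertible this can be used to make the
contact brackets with all `φ^a` vanish at one given point `p` (`exists_adapted`). For three
functions adapted in this way the correction term of an inner bracket is a sum of products with two
factors vanishing at `p`, so neither its value nor its differential at `p` is seen: the iterated
Dirac-Jacobi brackets at `p` are those of the contact bracket (`djBracket_djBracket_of_adapted`),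
and the Jacobi identity is inherited. A first order bracket satisfying the Jacobi identity yields
the Schouten identities for its bivector and field (`jacobiStructure_of_jacobi`).

The dynamics. For a solution `X` the covector `♭(X) - (dh - (R(h) + h) η)` is a multiple of `η` on
`T M₁`. After subtracting that multiple it annihilates `T N`, so by Lagrange multipliers it is a
combination of the differentials of the constraints. Evaluation on `R` fixes the multiple of `η` to
be the one that turns each differential `dψ` into `♭(X_ψ)`, and applying `♯` gives the decomposition
of `X`. Tangency to the second class constraints is then the linear system `u C = -{h, φ}`, and
inserting its solution into `X(f)` produces the correction terms of the Dirac-Jacobi bracket. -/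

lemma two_le_smooth : (2 : ℕ∞ω) ≤ ∞ :=
  WithTop.coe_le_coe.2 (le_top : (2 : ℕ∞) ≤ ⊤)

/-- The exterior derivative of a one-form on a normed space, as a bilinear map. -/
def curl (θ : E → E →L[ℝ] ℝ) (y : E) : E →L[ℝ] E →L[ℝ] ℝ :=
  fderiv ℝ θ y - (fderiv ℝ θ y).flip

lemma curl_apply (θ : E → E →L[ℝ] ℝ) (y v w : E) :
    curl θ y v w = fderiv ℝ θ y v w - fderiv ℝ θ y w v := rfl

lemma curl_swap (θ : E → E →L[ℝ] ℝ) (y v w : E) : curl θ y v w = -curl θ y w v := by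
  simp [curl_apply]

lemma differentiableAt_ofSubsingleton {θ : E → E →L[ℝ] ℝ} {y : E} (hθ : DifferentiableAt ℝ θ y) :
    DifferentiableAt ℝ
      (fun z => ContinuousAlternatingMap.ofSubsingleton ℝ E ℝ (0 : Fin 1) (θ z)) y :=
  (ContinuousAlternatingMap.ofSubsingletonLIE (𝕜 := ℝ) (E := E) (F := ℝ)
    (0 : Fin 1)).differentiableAt.comp y hθ

lemma extDeriv_ofSubsingleton {θ : E → E →L[ℝ] ℝ} {y : E} (hθ : DifferentiableAt ℝ θ y) (v w : E) :
    extDeriv (fun z => ContinuousAlternatingMap.ofSubsingleton ℝ E ℝ (0 : Fin 1) (θ z)) y ![v, w]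
      = curl θ y v w := by
  have h (u : E) : fderiv ℝ (fun z => θ z u) y = (fderiv ℝ θ y).flip u := by
    ext t
    rw [fderiv_clm_apply hθ (differentiableAt_const u)]
    simp
  rw [extDeriv_apply (differentiableAt_ofSubsingleton hθ)]
  simp [Fin.sum_univ_two, h, curl_apply, Fin.removeNth]
  ring

/-- `X` is a contact vector field of the one-form `θ` with Hamiltonian `f`:
`θ(X) = -f` and `L_X θ = -r θ`. -/
structure IsContactFieldOn (θ : E → E →L[ℝ] ℝ) (Ω : Set E) (f : E → ℝ) (X : E → E)
    (r : E → ℝ) : Prop where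
  smooth_ham : ContDiffOn ℝ ∞ f Ω
  smooth_field : ContDiffOn ℝ ∞ X Ω
  smooth_factor : ContDiffOn ℝ ∞ r Ω
  apply_field : ∀ y ∈ Ω, θ y (X y) = -f y
  curl_field : ∀ y ∈ Ω, ∀ w, curl θ y (X y) w = fderiv ℝ f y w - r y * θ y w

variable {θ : E → E →L[ℝ] ℝ} {Ω : Set E} {f g h r s q : E → ℝ} {X Y K Z : E → E} {y : E}

lemma differentiableAt_of_contDiffOn {F : Type*} [NormedAddCommGroup F] [NormedSpace ℝ F]
    {u : E → F} (hu : ContDiffOn ℝ ∞ u Ω) (hΩ : IsOpen Ω) (hy : y ∈ Ω) :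
    DifferentiableAt ℝ u y :=
  (hu.contDiffAt (hΩ.mem_nhds hy)).differentiableAt (by simp)

lemma fderiv_congr_on {F : Type*} [NormedAddCommGroup F] [NormedSpace ℝ F]
    {u v : E → F} (hΩ : IsOpen Ω) (h : ∀ z ∈ Ω, u z = v z) (hy : y ∈ Ω) :
    fderiv ℝ u y = fderiv ℝ v y :=
  Filter.EventuallyEq.fderiv_eq (Filter.eventuallyEq_of_mem (hΩ.mem_nhds hy) h)

lemma contDiffOn_fderiv_apply {F : Type*} [NormedAddCommGroup F] [NormedSpace ℝ F]
    {u : E → F} (hΩ : IsOpen Ω) (hu : ContDiffOn ℝ ∞ u Ω) (hX : ContDiffOn ℝ ∞ X Ω) :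
    ContDiffOn ℝ ∞ (fun z => fderiv ℝ u z (X z)) Ω :=
  (hu.fderiv_of_isOpen hΩ (by simp)).clm_apply hX

lemma contDiffOn_lieBracket (hΩ : IsOpen Ω) (hX : ContDiffOn ℝ ∞ X Ω) (hY : ContDiffOn ℝ ∞ Y Ω) :
    ContDiffOn ℝ ∞ (lieBracket ℝ X Y) Ω :=
  (contDiffOn_fderiv_apply hΩ hY hX).sub (contDiffOn_fderiv_apply hΩ hX hY)

/-- `(L_X θ)(Z) = -r θ(Z)`. -/
lemma IsContactFieldOn.lie_apply (hΩ : IsOpen Ω) (hθ : ContDiffOn ℝ ∞ θ Ω)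
    (hX : IsContactFieldOn θ Ω f X r) (hZ : ContDiffOn ℝ ∞ Z Ω) (hy : y ∈ Ω) :
    fderiv ℝ (fun z => θ z (Z z)) y (X y) = θ y (lieBracket ℝ X Z y) - r y * θ y (Z y) := by
  have dθ := differentiableAt_of_contDiffOn hθ hΩ hy
  have dX := differentiableAt_of_contDiffOn hX.smooth_field hΩ hy
  have dZ := differentiableAt_of_contDiffOn hZ hΩ hy
  have h1 := hX.curl_field y hy (Z y)
  -- The differential of `θ(X) = -f` is the `d i_X θ` half of Cartan's formula; `h1` is the half
  -- `i_X dθ`, and `df` cancels in the sum.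
  have h2 : fderiv ℝ (fun z => θ z (X z)) y = -fderiv ℝ f y := by
    rw [fderiv_congr_on hΩ hX.apply_field hy, fderiv_fun_neg]
  rw [fderiv_clm_apply dθ dX] at h2
  have h3 := DFunLike.congr_fun h2 (Z y)
  rw [fderiv_clm_apply dθ dZ]
  simp [lieBracket_eq, curl_apply] at h1 h3 ⊢
  linarith

/-- Converse of `IsContactFieldOn.lie_apply`. Constant fields suffice as test fields because `L_X θ`
is tensorial. -/
lemma IsContactFieldOn.of_lie_apply (hΩ : IsOpen Ω) (hθ : ContDiffOn ℝ ∞ θ Ω)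
    (hf : ContDiffOn ℝ ∞ f Ω) (hX : ContDiffOn ℝ ∞ X Ω) (hr : ContDiffOn ℝ ∞ r Ω)
    (hfX : ∀ y ∈ Ω, θ y (X y) = -f y)
    (hl : ∀ y ∈ Ω, ∀ w : E, fderiv ℝ (fun z => θ z w) y (X y) =
      θ y (lieBracket ℝ X (fun _ => w) y) - r y * θ y w) :
    IsContactFieldOn θ Ω f X r := by
  refine ⟨hf, hX, hr, hfX, fun y hy w => ?_⟩
  have dθ := differentiableAt_of_contDiffOn hθ hΩ hy
  have dX := differentiableAt_of_contDiffOn hX hΩ hy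
  have h2 : fderiv ℝ (fun z => θ z (X z)) y = -fderiv ℝ f y := by
    rw [fderiv_congr_on hΩ hfX hy, fderiv_fun_neg]
  rw [fderiv_clm_apply dθ dX] at h2
  have h3 := DFunLike.congr_fun h2 w
  have h1 := hl y hy w
  rw [fderiv_clm_apply dθ (differentiableAt_const w)] at h1
  simp [lieBracket_eq, curl_apply] at h1 h3 ⊢
  linarith

/-- Contact vector fields are closed under the Lie bracket. -/
lemma IsContactFieldOn.lieBracket (hΩ : IsOpen Ω) (hθ : ContDiffOn ℝ ∞ θ Ω)
    (hX : IsContactFieldOn θ Ω f X r) (hY : IsContactFieldOn θ Ω g Y s) :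
    IsContactFieldOn θ Ω (fun z => fderiv ℝ g z (X z) + g z * r z) (lieBracket ℝ X Y)
      (fun z => fderiv ℝ s z (X z) - fderiv ℝ r z (Y z)) := by
  have hXY := contDiffOn_lieBracket hΩ hX.smooth_field hY.smooth_field
  refine .of_lie_apply hΩ hθ ((contDiffOn_fderiv_apply hΩ hY.smooth_ham hX.smooth_field).add
    (hY.smooth_ham.mul hX.smooth_factor)) hXY
    ((contDiffOn_fderiv_apply hΩ hY.smooth_factor hX.smooth_field).sub
      (contDiffOn_fderiv_apply hΩ hX.smooth_factor hY.smooth_field)) (fun y hy => ?_)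
    (fun y hy w => ?_)
  -- The Hamiltonian of `[X, Y]` is `-θ([X, Y])`, which is read off from `(L_X θ)(Y) = -r θ(Y)`.
  · have h1 := hX.lie_apply hΩ hθ hY.smooth_field hy
    rw [fderiv_congr_on hΩ hY.apply_field hy, hY.apply_field y hy, fderiv_fun_neg] at h1
    simp at h1
    linarith
  · have cw : ContDiffOn ℝ ∞ (fun _ : E => w) Ω := contDiffOn_const
    have cYw := contDiffOn_lieBracket hΩ hY.smooth_field cw
    have cXw := contDiffOn_lieBracket hΩ hX.smooth_field cw
    have cθw : ContDiffOn ℝ ∞ (fun z => θ z w) Ω := hθ.clm_apply cw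
    have dθw := differentiableAt_of_contDiffOn cθw hΩ hy
    have at_ {u : E → E} (hu : ContDiffOn ℝ ∞ u Ω) := hu.contDiffAt (hΩ.mem_nhds hy)
    -- `L_[X,Y] = [L_X, L_Y]` on `θ`, tested on the constant field `w`: `jac` is the Jacobi identity
    -- of vector fields, `com` says that `[X, Y]` acts on functions as a commutator. The terms `r s
    -- θ(w)` cancel.
    have jac := leibniz_identity_lieBracket (𝕜 := ℝ) (n := ∞) (by simp [two_le_smooth]) (at_ hX.smooth_field)
      (at_ hY.smooth_field) (at_ cw)
    have com := fderiv_apply_lieBracket (𝕜 := ℝ) (n := ∞)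
      (cθw.contDiffAt (hΩ.mem_nhds hy)) (by simp [two_le_smooth])
      (differentiableAt_of_contDiffOn hY.smooth_field hΩ hy)
      (differentiableAt_of_contDiffOn hX.smooth_field hΩ hy)
    have expand {f' r' : E → ℝ} {X' Y' : E → E} (hX' : IsContactFieldOn θ Ω f' X' r')
        (hc : ContDiffOn ℝ ∞ (VectorField.lieBracket ℝ X' (fun _ => w)) Ω) :
        fderiv ℝ (fun z => fderiv ℝ (fun z => θ z w) z (X' z)) y (Y' y) =
        fderiv ℝ (fun z => θ z (VectorField.lieBracket ℝ X' (fun _ => w) z)) y (Y' y)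
          - (fderiv ℝ r' y (Y' y) * θ y w + r' y * fderiv ℝ (fun z => θ z w) y (Y' y)) := by
      rw [fderiv_congr_on hΩ (fun z hz => hX'.lie_apply hΩ hθ cw hz) hy]
      have d1 := differentiableAt_of_contDiffOn (hθ.clm_apply hc) hΩ hy
      have d2 := differentiableAt_of_contDiffOn hX'.smooth_factor hΩ hy
      rw [fderiv_fun_sub d1 (d2.fun_mul dθw), fderiv_fun_mul d2 dθw]
      simp
      ring
    rw [com, expand hY cYw, expand hX cXw, hX.lie_apply hΩ hθ cYw hy, hY.lie_apply hΩ hθ cXw hy,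
      hX.lie_apply hΩ hθ cw hy, hY.lie_apply hΩ hθ cw hy, jac]
    simp
    ring

/-- Evaluating the curl equation on a Reeb vector isolates the factor; the difference of the two
fields is then in the kernel of `♭`. -/
lemma IsContactFieldOn.unique
    (hnd : ∀ y ∈ Ω, ∀ v, (∀ w, curl θ y v w + θ y v * θ y w = 0) → v = 0)
    (hreeb : ∀ y ∈ Ω, ∃ v, θ y v = 1 ∧ ∀ w, curl θ y v w = 0)
    (hX : IsContactFieldOn θ Ω f X r) (hY : IsContactFieldOn θ Ω f Y s) (hy : y ∈ Ω) :
    X y = Y y ∧ r y = s y := by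
  obtain ⟨R, hR, hR'⟩ := hreeb y hy
  have hr : r y = s y := by
    have h1 := hX.curl_field y hy R
    have h2 := hY.curl_field y hy R
    rw [curl_swap, hR', hR] at h1 h2
    linarith
  refine ⟨sub_eq_zero.1 (hnd y hy _ fun w => ?_), hr⟩
  simp [hX.curl_field y hy, hY.curl_field y hy, hX.apply_field y hy, hY.apply_field y hy, hr]

/-- The Jacobi identity for the bracket `{f, h} = X_f(h) + h r_f` of contact Hamiltonians. -/
lemma IsContactFieldOn.jacobi (hΩ : IsOpen Ω) (hθ : ContDiffOn ℝ ∞ θ Ω)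
    (hnd : ∀ y ∈ Ω, ∀ v, (∀ w, curl θ y v w + θ y v * θ y w = 0) → v = 0)
    (hreeb : ∀ y ∈ Ω, ∃ v, θ y v = 1 ∧ ∀ w, curl θ y v w = 0)
    (hX : IsContactFieldOn θ Ω f X r) (hY : IsContactFieldOn θ Ω g Y s)
    (hK : IsContactFieldOn θ Ω (fun z => fderiv ℝ g z (X z) + g z * r z) K q)
    (hh : ContDiffOn ℝ ∞ h Ω) (hy : y ∈ Ω) :
    (fderiv ℝ (fun z => fderiv ℝ h z (Y z) + h z * s z) y (X y)
        + (fderiv ℝ h y (Y y) + h y * s y) * r y)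
      - (fderiv ℝ (fun z => fderiv ℝ h z (X z) + h z * r z) y (Y y)
        + (fderiv ℝ h y (X y) + h y * r y) * s y)
      = fderiv ℝ h y (K y) + h y * q y := by
  -- `K` and `[X, Y]` have the same Hamiltonian, so `K = [X, Y]` and `q = X(s) - Y(r)`. The claim
  -- becomes a commutator identity for the operators `X + r` and `Y + s`.
  obtain ⟨hKX, hq⟩ := hK.unique hnd hreeb (hX.lieBracket hΩ hθ hY) hy
  have d {u : E → ℝ} (hu : ContDiffOn ℝ ∞ u Ω) := differentiableAt_of_contDiffOn hu hΩ hy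
  have com := fderiv_apply_lieBracket (𝕜 := ℝ) (n := ∞)
    (hh.contDiffAt (hΩ.mem_nhds hy)) (by simp [two_le_smooth])
    (differentiableAt_of_contDiffOn hY.smooth_field hΩ hy)
    (differentiableAt_of_contDiffOn hX.smooth_field hΩ hy)
  rw [hKX, hq, com,
    fderiv_fun_add (d (contDiffOn_fderiv_apply hΩ hh hY.smooth_field))
      ((d hh).fun_mul (d hY.smooth_factor)),
    fderiv_fun_add (d (contDiffOn_fderiv_apply hΩ hh hX.smooth_field))
      ((d hh).fun_mul (d hX.smooth_factor)),
    fderiv_fun_mul (d hh) (d hY.smooth_factor), fderiv_fun_mul (d hh) (d hX.smooth_factor)]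
  simp
  ring

end Coordinates

/-! ### Vector fields, one-forms and the exterior derivative in a chart -/

section Charts

open Bundle Set

variable {E : Type*} [NormedAddCommGroup E] [NormedSpace ℝ E]
  {W : Type*} [TopologicalSpace W] (I : ModelWithCorners ℝ E W)
  {M : Type*} [TopologicalSpace M] [ChartedSpace W M]

/-- The derivative at `x` of the preferred chart at `p`. -/
def toModel (p x : M) : TangentSpace I x →L[ℝ] E := mfderiv I 𝓘(ℝ, E) (extChartAt I p) x

/-- The inverse of the derivative at `x` of the preferred chart at `p`. -/
def ofModel (p x : M) : E →L[ℝ] TangentSpace I x := (toModel I p x).inverse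

variable {I} {p x : M}

section
variable [IsManifold I ∞ M]

lemma toModel_isInvertible (hx : x ∈ (extChartAt I p).source) : (toModel I p x).IsInvertible :=
  isInvertible_mfderiv_extChartAt hx

lemma ofModel_toModel (hx : x ∈ (extChartAt I p).source) (v : TangentSpace I x) :
    ofModel I p x (toModel I p x v) = v :=
  (toModel_isInvertible hx).inverse_apply_self v

lemma toModel_ofModel (hx : x ∈ (extChartAt I p).source) (v : E) :
    toModel I p x (ofModel I p x v) = v :=
  (toModel_isInvertible hx).self_apply_inverse v

/-- Smoothness of a vector field, read in a chart. -/
lemma smoothFieldWithinAt_iff {S : Set M} {X : (p : M) → TangentSpace I p} :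
    ContMDiffWithinAt I I.tangent ∞ (fun q => (⟨q, X q⟩ : TangentBundle I M)) S p ↔
      ContMDiffWithinAt I 𝓘(ℝ, E) ∞ (fun q => toModel I p q (X q)) S p := by
  have h := Trivialization.contMDiffWithinAt_section (IB := I) (n := ∞) S
    (e := trivializationAt E (TangentSpace I) p) (s := X) (mem_baseSet_trivializationAt E _ p)
  have he : (fun q => (trivializationAt E (TangentSpace I) p ⟨q, X q⟩).2) =ᶠ[𝓝 p]
      fun q => toModel I p q (X q) := by
    filter_upwards [(chartAt W p).open_source.mem_nhds (mem_chart_source W p)] with q hq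
    have := DFunLike.congr_fun (TangentBundle.continuousLinearMapAt_trivializationAt (I := I) hq)
      (X q)
    rw [toModel, ← this, Trivialization.continuousLinearMapAt_apply,
      Trivialization.linearMapAt_apply, if_pos (by simpa using hq)]
  refine h.trans ⟨fun h => ?_, fun h => ?_⟩
  · exact h.congr_of_eventuallyEq (he.symm.filter_mono nhdsWithin_le_nhds) he.self_of_nhds.symm
  · exact h.congr_of_eventuallyEq (he.filter_mono nhdsWithin_le_nhds) he.self_of_nhds

variable [I.Boundaryless]

lemma mdifferentiableAt_symm {y : E} (hy : y ∈ (extChartAt I p).target) :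
    MDifferentiableAt 𝓘(ℝ, E) I (extChartAt I p).symm y :=
  (mdifferentiableOn_extChartAt_symm y hy).mdifferentiableAt
    ((isOpen_extChartAt_target p).mem_nhds hy)

lemma mfderiv_symm_toModel (hx : x ∈ (extChartAt I p).source) (v : TangentSpace I x) :
    (mfderiv 𝓘(ℝ, E) I (extChartAt I p).symm (extChartAt I p x) (toModel I p x v) : E) = v := by
  have h := mfderivWithin_extChartAt_symm_comp_mfderiv_extChartAt' (I := I) (x := p) hx
  rw [mfderivWithin_of_mem_nhds (by simp [I.range_eq_univ])] at h
  exact DFunLike.congr_fun h v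

lemma mvfderiv_eq_fderiv_chart {f : M → ℝ} (hx : x ∈ (extChartAt I p).source)
    (hf : MDifferentiableAt I 𝓘(ℝ, ℝ) f x) (v : TangentSpace I x) :
    mvfderiv I f x v =
      fderiv ℝ (f ∘ (extChartAt I p).symm) (extChartAt I p x) (toModel I p x v) := by
  have hy := (extChartAt I p).map_source hx
  have hxy := (extChartAt I p).left_inv hx
  -- Going through the chart and back returns `x` only up to a propositional equality of base
  -- points; the fibres are compared by substituting along it. The same device recurs below.
  have key (x' : M) (h : x' = x) (u : E) (hu : u = v) :
      (mfderiv I 𝓘(ℝ, ℝ) f x' : E → ℝ) u = mvfderiv I f x v := by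
    subst h hu; rfl
  rw [← mfderiv_eq_fderiv, mfderiv_comp_of_eq hf (mdifferentiableAt_symm hy) hxy]
  exact (key _ hxy _ (mfderiv_symm_toModel hx v)).symm

lemma formInChart_toModel (η : (p : M) → TangentSpace I p →L[ℝ] ℝ)
    (hx : x ∈ (extChartAt I p).source) (v : TangentSpace I x) :
    formInChart I η p (extChartAt I p x) (toModel I p x v) = η x v := by
  have key (x' : M) (h : x' = x) (u : E) (hu : u = v) : (η x' : E → ℝ) u = η x v := by
    subst h hu; rfl
  exact key _ ((extChartAt I p).left_inv hx) _ (mfderiv_symm_toModel hx v)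

/-- The expression of a smooth one-form in a chart is smooth. -/
lemma contDiffOn_formInChart {η : (p : M) → TangentSpace I p →L[ℝ] ℝ} (hη : IsSmoothForm I η)
    (p : M) : ContDiffOn ℝ ∞ (formInChart I η p) (extChartAt I p).target := by
  have h1 : ContMDiffOn I 𝓘(ℝ, E →L[ℝ] ℝ) ∞ (fun x => formInChart I η p (extChartAt I p x))
      (extChartAt I p).source := by
    intro x hx
    have hx' : x ∈ (chartAt W p).source := by simpa using hx
    have hb : x ∈ (trivializationAt (E →L[ℝ] ℝ)
        (fun q : M => TangentSpace I q →L[ℝ] Bundle.Trivial M ℝ q) p).baseSet := by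
      simpa using hx'
    have h := (Trivialization.contMDiffAt_section_iff (IB := I) (n := ∞)
      (trivializationAt (E →L[ℝ] ℝ)
        (fun q : M => TangentSpace I q →L[ℝ] Bundle.Trivial M ℝ q) p) hb (s := η)).1 (hη x)
    refine (h.congr_of_eventuallyEq ?_).contMDiffWithinAt
    filter_upwards [(isOpen_extChartAt_source (I := I) p).mem_nhds hx] with z hz
    have hz' : z ∈ (chartAt W p).source := by simpa using hz
    rw [hom_trivializationAt_apply]
    ext u
    have hu : toModel I p z ((trivializationAt E (TangentSpace I) p).symmL ℝ z u) = u := by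
      rw [toModel, ← TangentBundle.continuousLinearMapAt_trivializationAt hz']
      exact Trivialization.continuousLinearMapAt_symmL _ (by simpa using hz') u
    have h3 := formInChart_toModel η hz ((trivializationAt E (TangentSpace I) p).symmL ℝ z u)
    rw [hu] at h3
    rw [h3]
    simp [ContinuousLinearMap.inCoordinates]
  have h2 := h1.comp (contMDiffOn_extChartAt_symm p) (fun y hy => (extChartAt I p).map_target hy)
  refine (contMDiffOn_iff_contDiffOn.1 h2).congr fun y hy => ?_
  rw [Function.comp_apply, (extChartAt I p).right_inv hy]

lemma toModel_mfderiv_symm {z : E} (hz : z ∈ (extChartAt I x).target)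
    (hz' : (extChartAt I x).symm z ∈ (extChartAt I p).source)
    (u : E) :
    toModel I p ((extChartAt I x).symm z)
      (mfderiv 𝓘(ℝ, E) I (extChartAt I x).symm z u) =
      fderiv ℝ (extChartAt I p ∘ (extChartAt I x).symm) z u := by
  have h := mfderiv_comp z (mdifferentiableAt_extChartAt (I := I) (by simpa using hz'))
    (mdifferentiableAt_symm hz)
  rw [← mfderiv_eq_fderiv, h]
  rfl

omit [IsManifold I ∞ M] in
lemma eventually_mem_chart (hx : x ∈ (extChartAt I p).source) :
    ∀ᶠ z in 𝓝 (extChartAt I x x), z ∈ (extChartAt I x).target ∧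
      (extChartAt I x).symm z ∈ (extChartAt I p).source := by
  refine Filter.Eventually.and (extChartAt_target_mem_nhds x) ?_
  refine (continuousAt_extChartAt_symm x).eventually_mem
    ((isOpen_extChartAt_source (I := I) p).mem_nhds ?_)
  simpa using hx

lemma formInChart_eventuallyEq (η : (p : M) → TangentSpace I p →L[ℝ] ℝ)
    (hx : x ∈ (extChartAt I p).source) :
    ∀ᶠ z in 𝓝 (extChartAt I x x), formInChart I η x z =
      (formInChart I η p ((extChartAt I p ∘ (extChartAt I x).symm) z)).comp
        (fderiv ℝ (extChartAt I p ∘ (extChartAt I x).symm) z) := by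
  filter_upwards [eventually_mem_chart hx] with z ⟨hz, hz'⟩
  ext u
  rw [ContinuousLinearMap.comp_apply, ← toModel_mfderiv_symm hz hz', Function.comp_apply,
    formInChart_toModel η hz']
  rfl

/-- `dForm` uses at each point the chart preferred at that point. Since the exterior derivative
commutes with pullback by transition maps, every chart around `x` gives the same value, so a single
chart serves on a whole neighbourhood. -/
lemma dForm_eq_curl {η : (p : M) → TangentSpace I p →L[ℝ] ℝ} (hη : IsSmoothForm I η)
    (hx : x ∈ (extChartAt I p).source) (v w : TangentSpace I x) :
    dForm I η x v w =
      curl (formInChart I η p) (extChartAt I p x) (toModel I p x v) (toModel I p x w) := by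
  have hxx := (extChartAt I x).left_inv (mem_extChartAt_source (I := I) x)
  have hτ : (extChartAt I p ∘ (extChartAt I x).symm) (extChartAt I x x) = extChartAt I p x := by
    rw [Function.comp_apply, hxx]
  have hdθ : DifferentiableAt ℝ (formInChart I η p) (extChartAt I p x) :=
    differentiableAt_of_contDiffOn (contDiffOn_formInChart hη p) (isOpen_extChartAt_target p)
      ((extChartAt I p).map_source hx)
  have hcτ : ContDiffAt ℝ ∞ (extChartAt I p ∘ (extChartAt I x).symm) (extChartAt I x x) := by
    refine ContMDiffAt.contDiffAt (ContMDiffAt.comp_of_eq (y := x) (I' := I) ?_ ?_ hxx)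
    · exact contMDiffAt_extChartAt' (by simpa using hx)
    · exact (contMDiffOn_extChartAt_symm x).contMDiffAt (extChartAt_target_mem_nhds x)
  have hd (u : TangentSpace I x) : fderiv ℝ (extChartAt I p ∘ (extChartAt I x).symm)
      (extChartAt I x x) (toModel I x x u) = toModel I p x u := by
    obtain ⟨h1, h2⟩ := (eventually_mem_chart hx).self_of_nhds
    have key (x' : M) (h : x' = x) (t : E) (ht : t = u) :
        (toModel I p x' : E → E) t = toModel I p x u := by
      subst h ht; rfl
    rw [← toModel_mfderiv_symm h1 h2]
    exact key _ hxx _ (mfderiv_symm_toModel (mem_extChartAt_source x) u)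
  have he := formInChart_eventuallyEq η hx
  have he' : (fun z => ContinuousAlternatingMap.ofSubsingleton ℝ E ℝ (0 : Fin 1)
      (formInChart I η x z)) =ᶠ[𝓝 (extChartAt I x x)]
      fun z => (ContinuousAlternatingMap.ofSubsingleton ℝ E ℝ (0 : Fin 1)
        (formInChart I η p ((extChartAt I p ∘ (extChartAt I x).symm) z))).compContinuousLinearMap
        (fderiv ℝ (extChartAt I p ∘ (extChartAt I x).symm) z) := by
    filter_upwards [he] with z hz
    rw [hz]
    ext m
    simp
  unfold dForm
  have hd1 : DifferentiableAt ℝ (fun y => ContinuousAlternatingMap.ofSubsingleton ℝ E ℝ (0 : Fin 1)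
      (formInChart I η p y)) ((extChartAt I p ∘ (extChartAt I x).symm) (extChartAt I x x)) := by
    rw [hτ]
    exact differentiableAt_ofSubsingleton hdθ
  rw [he'.extDeriv_eq, extDeriv_pullback hd1 hcτ (by simp [two_le_smooth]), hτ,
    ← extDeriv_ofSubsingleton hdθ, ContinuousAlternatingMap.compContinuousLinearMap_apply]
  congr 1
  ext i
  fin_cases i
  · exact hd v
  · exact hd w

end

end Charts

/-! ### Skew forms in odd dimension -/

section LinearAlgebra

/-- A skew-symmetric bilinear form on an odd-dimensional space is degenerate. -/
lemma exists_ne_zero_of_skew_of_odd {V : Type*} [AddCommGroup V] [Module ℝ V]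
    [FiniteDimensional ℝ V] (hodd : Odd (Module.finrank ℝ V)) (B : V →ₗ[ℝ] V →ₗ[ℝ] ℝ)
    (hB : ∀ v w, B v w = -B w v) : ∃ v, v ≠ 0 ∧ ∀ w, B v w = 0 := by
  let b := Module.finBasis ℝ V
  let A : Matrix (Fin (Module.finrank ℝ V)) (Fin (Module.finrank ℝ V)) ℝ :=
    Matrix.of fun i j => B (b i) (b j)
  have hA : A.transpose = -A := by
    ext i j
    simp [A, hB (b j) (b i)]
  -- `det A = det Aᵀ = det (-A) = -det A`, the size being odd.
  have hdet : A.det = 0 := by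
    have h := A.det_transpose
    rw [hA, Matrix.det_neg, Fintype.card_fin, hodd.neg_one_pow] at h
    linarith
  obtain ⟨c, hc, hc'⟩ := Matrix.exists_vecMul_eq_zero_iff.2 hdet
  refine ⟨∑ i, c i • b i, fun h => hc ?_, fun w => ?_⟩
  · funext i
    exact Fintype.linearIndependent_iff.1 b.linearIndependent c h i
  · have hl : B (∑ i, c i • b i) = 0 := by
      refine b.ext fun j => ?_
      have := congrFun hc' j
      simpa [Matrix.vecMul, dotProduct, A] using this
    rw [hl, LinearMap.zero_apply]

/-- A nonzero vector in the kernel of `B` cannot lie in the kernel of `θ`, so it can be rescaled. -/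
lemma exists_reeb_of_odd {V : Type*} [AddCommGroup V] [Module ℝ V]
    [FiniteDimensional ℝ V] (hodd : Odd (Module.finrank ℝ V)) (B : V →ₗ[ℝ] V →ₗ[ℝ] ℝ)
    (hB : ∀ v w, B v w = -B w v) (θ : V →ₗ[ℝ] ℝ)
    (hnd : ∀ v, θ v = 0 → (∀ w, B v w = 0) → v = 0) : ∃ v, θ v = 1 ∧ ∀ w, B v w = 0 := by
  obtain ⟨v, hv, hvB⟩ := exists_ne_zero_of_skew_of_odd hodd B hB
  have hθ : θ v ≠ 0 := fun h => hv (hnd v h hvB)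
  exact ⟨(θ v)⁻¹ • v, by simp [hθ], fun w => by simp [hvB]⟩

end LinearAlgebra

/-! ### Contact forms on an open subset of a normed space -/

section Coordinates

variable {E : Type*} [NormedAddCommGroup E] [NormedSpace ℝ E]

/-- The map `v ↦ i_v dθ + θ(v) θ`. -/
def coordFlat (θ : E → E →L[ℝ] ℝ) (y : E) : E →L[ℝ] E →L[ℝ] ℝ :=
  curl θ y + (θ y).smulRight (θ y)

lemma coordFlat_apply (θ : E → E →L[ℝ] ℝ) (y v w : E) :
    coordFlat θ y v w = curl θ y v w + θ y v * θ y w := by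
  simp [coordFlat]

/-- The Reeb vector field of a contact form on an open set of a normed space. -/
def coordReeb (θ : E → E →L[ℝ] ℝ) (y : E) : E := (coordFlat θ y).inverse (θ y)

/-- The contact Hamiltonian vector field on an open set of a normed space. -/
def coordHam (θ : E → E →L[ℝ] ℝ) (f : E → ℝ) (y : E) : E :=
  (coordFlat θ y).inverse
    (fderiv ℝ f y - (fderiv ℝ f y (coordReeb θ y) + f y) • θ y)

/-- The Jacobi bracket of a contact form on an open set of a normed space. -/
def coordBracket (θ : E → E →L[ℝ] ℝ) (f g : E → ℝ) (y : E) : ℝ :=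
  fderiv ℝ g y (coordHam θ f y) + g y * fderiv ℝ f y (coordReeb θ y)

/-- Contact forms on an open set of a normed space. -/
structure IsCoordContactOn (θ : E → E →L[ℝ] ℝ) (Ω : Set E) : Prop where
  isOpen : IsOpen Ω
  smooth : ContDiffOn ℝ ∞ θ Ω
  invertible : ∀ y ∈ Ω, (coordFlat θ y).IsInvertible
  exists_reeb : ∀ y ∈ Ω, ∃ v, θ y v = 1 ∧ ∀ w, curl θ y v w = 0

namespace IsCoordContactOn

variable {θ : E → E →L[ℝ] ℝ} {Ω : Set E} {f g h : E → ℝ} {y : E}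

lemma flat_inverse (hθ : IsCoordContactOn θ Ω) (hy : y ∈ Ω) (α : E →L[ℝ] ℝ) (w : E) :
    curl θ y ((coordFlat θ y).inverse α) w + θ y ((coordFlat θ y).inverse α) * θ y w = α w := by
  rw [← coordFlat_apply, (hθ.invertible y hy).self_apply_inverse]

lemma eq_inverse (hθ : IsCoordContactOn θ Ω) (hy : y ∈ Ω) {α : E →L[ℝ] ℝ} {v : E}
    (hv : ∀ w, curl θ y v w + θ y v * θ y w = α w) : v = (coordFlat θ y).inverse α := by
  have : coordFlat θ y v = α := by
    ext w
    rw [coordFlat_apply, hv]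
  rw [← this, (hθ.invertible y hy).inverse_apply_self]

lemma nondegenerate (hθ : IsCoordContactOn θ Ω) (hy : y ∈ Ω) {v : E}
    (hv : ∀ w, curl θ y v w + θ y v * θ y w = 0) : v = 0 := by
  have h := hθ.eq_inverse hy (α := 0) (v := v) (by simpa using hv)
  rw [h, map_zero]

/-- A Reeb vector is mapped to `θ` by `♭`, so it is `♭⁻¹(θ)`; this formula also gives its smooth
dependence on the point. -/
lemma reeb_spec (hθ : IsCoordContactOn θ Ω) (hy : y ∈ Ω) :
    θ y (coordReeb θ y) = 1 ∧ ∀ w, curl θ y (coordReeb θ y) w = 0 := by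
  obtain ⟨v, hv, hv'⟩ := hθ.exists_reeb y hy
  have : v = coordReeb θ y := hθ.eq_inverse hy fun w => by rw [hv, hv']; ring
  exact this ▸ ⟨hv, hv'⟩

lemma apply_inverse (hθ : IsCoordContactOn θ Ω) (hy : y ∈ Ω) (α : E →L[ℝ] ℝ) :
    θ y ((coordFlat θ y).inverse α) = α (coordReeb θ y) := by
  have h := hθ.flat_inverse hy α (coordReeb θ y)
  rwa [curl_swap, (hθ.reeb_spec hy).2, (hθ.reeb_spec hy).1, mul_one, neg_zero, zero_add] at h

variable [CompleteSpace E]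

/-- Inversion of operators is smooth at invertible ones when the space is complete. The smoothness
of the Reeb field, of Hamiltonian fields and of brackets rests on this. -/
lemma contDiffOn_inverse (hθ : IsCoordContactOn θ Ω) {α : E → E →L[ℝ] ℝ}
    (hα : ContDiffOn ℝ ∞ α Ω) : ContDiffOn ℝ ∞ (fun y => (coordFlat θ y).inverse (α y)) Ω := by
  have hD : ContDiffOn ℝ ∞ (fderiv ℝ θ) Ω := hθ.smooth.fderiv_of_isOpen hθ.isOpen (by simp)
  have h1 : ContDiffOn ℝ ∞ (coordFlat θ) Ω := by
    refine (hD.sub ?_).add (hθ.smooth.smulRight hθ.smooth)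
    have hflip : ContDiff ℝ ∞ (ContinuousLinearMap.flip : (E →L[ℝ] E →L[ℝ] ℝ) → _) := by
      let L : (E →L[ℝ] E →L[ℝ] ℝ) →L[ℝ] E →L[ℝ] E →L[ℝ] ℝ :=
        (ContinuousLinearMap.flipₗᵢ ℝ E E ℝ).toContinuousLinearEquiv.toContinuousLinearMap
      exact ContinuousLinearMap.contDiff (𝕜 := ℝ) (E := E →L[ℝ] E →L[ℝ] ℝ)
        (F := E →L[ℝ] E →L[ℝ] ℝ) L
    exact hflip.comp_contDiffOn hD
  refine ContDiffOn.clm_apply (fun y hy => ?_) hα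
  obtain ⟨e, he⟩ := hθ.invertible y hy
  exact ((he ▸ contDiffAt_map_inverse e :
    ContDiffAt ℝ ∞ ContinuousLinearMap.inverse (coordFlat θ y))).comp_contDiffWithinAt y (h1 y hy)

lemma contDiffOn_reeb (hθ : IsCoordContactOn θ Ω) : ContDiffOn ℝ ∞ (coordReeb θ) Ω :=
  hθ.contDiffOn_inverse hθ.smooth

lemma contDiffOn_reebDeriv (hθ : IsCoordContactOn θ Ω) (hf : ContDiffOn ℝ ∞ f Ω) :
    ContDiffOn ℝ ∞ (fun y => fderiv ℝ f y (coordReeb θ y)) Ω :=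
  contDiffOn_fderiv_apply hθ.isOpen hf hθ.contDiffOn_reeb

lemma contDiffOn_ham (hθ : IsCoordContactOn θ Ω) (hf : ContDiffOn ℝ ∞ f Ω) :
    ContDiffOn ℝ ∞ (coordHam θ f) Ω :=
  hθ.contDiffOn_inverse ((hf.fderiv_of_isOpen hθ.isOpen (by simp)).sub
    (((hθ.contDiffOn_reebDeriv hf).add hf).smul hθ.smooth))

lemma isContactFieldOn (hθ : IsCoordContactOn θ Ω) (hf : ContDiffOn ℝ ∞ f Ω) :
    IsContactFieldOn θ Ω f (coordHam θ f) (fun y => fderiv ℝ f y (coordReeb θ y)) := by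
  have h1 : ∀ y ∈ Ω, θ y (coordHam θ f y) = -f y := fun y hy => by
    rw [coordHam, hθ.apply_inverse hy]
    simp [(hθ.reeb_spec hy).1]
  refine ⟨hf, hθ.contDiffOn_ham hf, hθ.contDiffOn_reebDeriv hf, h1, fun y hy w => ?_⟩
  have h2 := hθ.flat_inverse hy (fderiv ℝ f y - (fderiv ℝ f y (coordReeb θ y) + f y) • θ y) w
  change curl θ y (coordHam θ f y) w + θ y (coordHam θ f y) * θ y w = _ at h2
  rw [h1 y hy] at h2
  simp at h2
  linarith

lemma contDiffOn_bracket (hθ : IsCoordContactOn θ Ω) (hf : ContDiffOn ℝ ∞ f Ω)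
    (hg : ContDiffOn ℝ ∞ g Ω) : ContDiffOn ℝ ∞ (coordBracket θ f g) Ω :=
  (contDiffOn_fderiv_apply hθ.isOpen hg (hθ.contDiffOn_ham hf)).add
    (hg.mul (hθ.contDiffOn_reebDeriv hf))

lemma jacobi (hθ : IsCoordContactOn θ Ω) (hf : ContDiffOn ℝ ∞ f Ω)
    (hg : ContDiffOn ℝ ∞ g Ω) (hh : ContDiffOn ℝ ∞ h Ω) (hy : y ∈ Ω) :
    coordBracket θ f (coordBracket θ g h) y - coordBracket θ g (coordBracket θ f h) y =
      coordBracket θ (coordBracket θ f g) h y :=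
  (hθ.isContactFieldOn hf).jacobi hθ.isOpen hθ.smooth (fun _ hz _ => hθ.nondegenerate hz)
    hθ.exists_reeb (hθ.isContactFieldOn hg)
    (hθ.isContactFieldOn (hθ.contDiffOn_bracket hf hg)) hh hy

end IsCoordContactOn

/-- Locality of the bracket, needed to replace an inner bracket by its chart expression. -/
lemma coordBracket_congr {θ : E → E →L[ℝ] ℝ} {f f' g g' : E → ℝ} {y : E} (hf : f =ᶠ[𝓝 y] f')
    (hg : g =ᶠ[𝓝 y] g') : coordBracket θ f g y = coordBracket θ f' g' y := by
  simp only [coordBracket, coordHam, hf.fderiv_eq, hg.fderiv_eq, hf.self_of_nhds, hg.self_of_nhds]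

end Coordinates

/-! ### A contact form read in a chart -/

section Contact

/-- The space and its dual have the same finite dimension. -/
lemma isInvertible_of_injective {E : Type*} [NormedAddCommGroup E] [NormedSpace ℝ E]
    [FiniteDimensional ℝ E] {B : E →L[ℝ] E →L[ℝ] ℝ} (hB : ∀ v, B v = 0 → v = 0) :
    B.IsInvertible := by
  have hdim : Module.finrank ℝ E = Module.finrank ℝ (E →L[ℝ] ℝ) := by
    rw [← Subspace.dual_finrank_eq, (LinearMap.toContinuousLinearMap (𝕜 := ℝ) (E := E)
      (F' := ℝ)).finrank_eq]
  have hinj : Function.Injective (B : E →ₗ[ℝ] E →L[ℝ] ℝ) :=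
    (injective_iff_map_eq_zero _).2 hB
  refine ⟨((B : E →ₗ[ℝ] E →L[ℝ] ℝ).linearEquivOfInjective hinj hdim).toContinuousLinearEquiv, ?_⟩
  ext v
  rfl


variable {E : Type*} [NormedAddCommGroup E] [NormedSpace ℝ E]
  {W : Type*} [TopologicalSpace W] {I : ModelWithCorners ℝ E W}
  {M : Type*} [TopologicalSpace M] [ChartedSpace W M]
  {η : (p : M) → TangentSpace I p →L[ℝ] ℝ} {p x : M}

/-- The exterior derivative of a one-form at a point, as a bilinear map. -/
def dFormLin (η : (p : M) → TangentSpace I p →L[ℝ] ℝ) (x : M) :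
    TangentSpace I x →ₗ[ℝ] TangentSpace I x →ₗ[ℝ] ℝ :=
  ((ContinuousLinearMap.coeLM ℝ).comp
    (curl (formInChart I η x) (extChartAt I x x) : E →ₗ[ℝ] E →L[ℝ] ℝ)).compl₁₂
    (toModel I x x : TangentSpace I x →ₗ[ℝ] E) (toModel I x x : TangentSpace I x →ₗ[ℝ] E)

variable [IsManifold I ∞ M] [I.Boundaryless]

lemma dForm_eq_dFormLin (hη : IsSmoothForm I η) (v w : TangentSpace I x) :
    dForm I η x v w = dFormLin η x v w :=
  dForm_eq_curl hη (mem_extChartAt_source x) v w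

lemma dForm_swap (hη : IsSmoothForm I η) (v w : TangentSpace I x) :
    dForm I η x v w = -dForm I η x w v := by
  rw [dForm_eq_curl hη (mem_extChartAt_source x), dForm_eq_curl hη (mem_extChartAt_source x)]
  exact curl_swap _ _ _ _

variable [FiniteDimensional ℝ E]

/-- A contact form, read in a chart. -/
lemma IsContactForm.coord (hη : IsContactForm I η) (p : M) {U : Set M} (hU : IsOpen U) :
    IsCoordContactOn (formInChart I η p)
      ((extChartAt I p).target ∩ (extChartAt I p).symm ⁻¹' U) := by
  obtain ⟨hs, ⟨n, hn⟩, hnd⟩ := hη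
  have hnd' (y : E) (hy : y ∈ (extChartAt I p).target) (v : E)
      (h1 : formInChart I η p y v = 0) (h2 : ∀ w, curl (formInChart I η p) y v w = 0) :
      v = 0 := by
    obtain ⟨x, hx, rfl⟩ : ∃ x ∈ (extChartAt I p).source, extChartAt I p x = y :=
      ⟨_, (extChartAt I p).map_target hy, (extChartAt I p).right_inv hy⟩
    rw [← toModel_ofModel hx v] at h1 h2
    rw [formInChart_toModel η hx] at h1
    have h3 := hnd x _ h1 fun w => by rw [dForm_eq_curl hs hx, h2]
    rw [← toModel_ofModel hx v, h3, map_zero]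
  refine ⟨(continuousOn_extChartAt_symm p).isOpen_inter_preimage (isOpen_extChartAt_target p) hU,
    (contDiffOn_formInChart hs p).mono Set.inter_subset_left, fun y hy => ?_, fun y hy => ?_⟩
  · refine isInvertible_of_injective fun v hv => ?_
    have h1 (w : E) : curl (formInChart I η p) y v w +
        formInChart I η p y v * formInChart I η p y w = 0 := by
      rw [← coordFlat_apply, hv, zero_apply]
    -- For `w = v` the skew term vanishes and leaves `θ(v)² = 0`.
    have h2 : formInChart I η p y v = 0 := by
      have h3 := h1 v
      have h4 := curl_swap (formInChart I η p) y v v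
      nlinarith
    exact hnd' y hy.1 v h2 fun w => by simpa [h2] using h1 w
  · obtain ⟨v, hv, hv'⟩ := exists_reeb_of_odd (V := E) (hn ▸ odd_two_mul_add_one n)
      ((ContinuousLinearMap.coeLM ℝ).comp (curl (formInChart I η p) y : E →ₗ[ℝ] E →L[ℝ] ℝ))
      (fun v w => curl_swap _ _ _ _) (formInChart I η p y : E →ₗ[ℝ] ℝ)
      (fun v h1 h2 => hnd' y hy.1 v h1 h2)
    exact ⟨v, hv, hv'⟩

end Contact

/-! ### Pointwise calculus of a contact form -/

section ContactPointwise

variable {E : Type*} [NormedAddCommGroup E] [NormedSpace ℝ E] [FiniteDimensional ℝ E]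
  {W : Type*} [TopologicalSpace W] {I : ModelWithCorners ℝ E W}
  {M : Type*} [TopologicalSpace M] [ChartedSpace W M]
  [IsManifold I ∞ M] [I.Boundaryless]
  {η : (p : M) → TangentSpace I p →L[ℝ] ℝ} {p x : M}

namespace IsContactForm

lemma coord_at (hη : IsContactForm I η) (hx : x ∈ (extChartAt I p).source) :
    ∃ Ω, IsCoordContactOn (formInChart I η p) Ω ∧ extChartAt I p x ∈ Ω :=
  ⟨_, hη.coord p isOpen_univ, (extChartAt I p).map_source hx, trivial⟩

omit [FiniteDimensional ℝ E] in
lemma flat_toModel (hη : IsContactForm I η) (hx : x ∈ (extChartAt I p).source)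
    (v w : TangentSpace I x) :
    dForm I η x v w + η x v * η x w =
      curl (formInChart I η p) (extChartAt I p x) (toModel I p x v) (toModel I p x w)
      + formInChart I η p (extChartAt I p x) (toModel I p x v)
        * formInChart I η p (extChartAt I p x) (toModel I p x w) := by
  rw [dForm_eq_curl hη.1 hx, formInChart_toModel η hx, formInChart_toModel η hx]

/-- Uniqueness of solutions of `♭(v) = α`. It identifies vectors obtained by choice, such as those
given by `sharp`, with the explicit inverse in a chart. -/
lemma toModel_eq_inverse (hη : IsContactForm I η) (hx : x ∈ (extChartAt I p).source)
    {α : TangentSpace I x →L[ℝ] ℝ} {v : TangentSpace I x}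
    (hv : ∀ w, dForm I η x v w + η x v * η x w = α w) :
    toModel I p x v = (coordFlat (formInChart I η p) (extChartAt I p x)).inverse
      (α.comp (ofModel I p x)) := by
  obtain ⟨Ω, hΩ, hy⟩ := hη.coord_at hx
  refine hΩ.eq_inverse hy fun w => ?_
  rw [ContinuousLinearMap.comp_apply, ← hv, hη.flat_toModel hx, toModel_ofModel hx]

lemma sharp_spec (hη : IsContactForm I η) (α : TangentSpace I x →L[ℝ] ℝ) (w : TangentSpace I x) :
    dForm I η x (sharp I η x α) w + η x (sharp I η x α) * η x w = α w := by
  have hx := mem_extChartAt_source (I := I) x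
  obtain ⟨Ω, hΩ, hy⟩ := hη.coord_at hx
  refine Classical.epsilon_spec
    (p := fun v => ∀ w, dForm I η x v w + η x v * η x w = α w) ⟨ofModel I x x
      ((coordFlat (formInChart I η x) (extChartAt I x x)).inverse (α.comp (ofModel I x x))),
      fun w => ?_⟩ w
  rw [hη.flat_toModel hx, toModel_ofModel hx, hΩ.flat_inverse hy, ContinuousLinearMap.comp_apply,
    ofModel_toModel hx]

lemma eq_sharp (hη : IsContactForm I η) {α : TangentSpace I x →L[ℝ] ℝ} {v : TangentSpace I x}
    (hv : ∀ w, dForm I η x v w + η x v * η x w = α w) : v = sharp I η x α := by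
  have hx := mem_extChartAt_source (I := I) x
  rw [← ofModel_toModel hx v, ← ofModel_toModel hx (sharp I η x α),
    hη.toModel_eq_inverse hx hv, hη.toModel_eq_inverse hx (hη.sharp_spec α)]

lemma sharp_add (hη : IsContactForm I η) (α β : TangentSpace I x →L[ℝ] ℝ) :
    sharp I η x (α + β) = sharp I η x α + sharp I η x β := by
  refine (hη.eq_sharp fun w => ?_).symm
  have h1 := hη.sharp_spec α w
  have h2 := hη.sharp_spec β w
  simp only [dForm_eq_dFormLin hη.1, map_add, LinearMap.add_apply, add_apply] at h1 h2 ⊢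
  linarith

lemma sharp_smul (hη : IsContactForm I η) (c : ℝ) (α : TangentSpace I x →L[ℝ] ℝ) :
    sharp I η x (c • α) = c • sharp I η x α := by
  refine (hη.eq_sharp fun w => ?_).symm
  have h1 := hη.sharp_spec α w
  simp only [dForm_eq_dFormLin hη.1, map_smul, LinearMap.smul_apply, smul_apply,
    smul_eq_mul] at h1 ⊢
  linear_combination c * h1

/-- The map `♯`, as a linear map. -/
def sharpLin (hη : IsContactForm I η) (x : M) :
    (TangentSpace I x →L[ℝ] ℝ) →ₗ[ℝ] TangentSpace I x where
  toFun := sharp I η x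
  map_add' := hη.sharp_add
  map_smul' := hη.sharp_smul

lemma sharpLin_apply (hη : IsContactForm I η) (α : TangentSpace I x →L[ℝ] ℝ) :
    hη.sharpLin x α = sharp I η x α := rfl

lemma sharp_sub (hη : IsContactForm I η) (α β : TangentSpace I x →L[ℝ] ℝ) :
    sharp I η x (α - β) = sharp I η x α - sharp I η x β :=
  map_sub (hη.sharpLin x) α β

lemma reeb_spec (hη : IsContactForm I η) (x : M) :
    η x (reeb I η x) = 1 ∧ ∀ w, dForm I η x (reeb I η x) w = 0 := by
  have hx := mem_extChartAt_source (I := I) x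
  obtain ⟨Ω, hΩ, hy⟩ := hη.coord_at hx
  obtain ⟨v, hv, hv'⟩ := hΩ.exists_reeb _ hy
  refine Classical.epsilon_spec (p := fun v => η x v = 1 ∧ ∀ w, dForm I η x v w = 0)
    ⟨ofModel I x x v, ?_, fun w => ?_⟩
  · rw [← formInChart_toModel η hx, toModel_ofModel hx, hv]
  · rw [dForm_eq_curl hη.1 hx, toModel_ofModel hx, hv']

lemma sharp_eta (hη : IsContactForm I η) (x : M) : sharp I η x (η x) = reeb I η x := by
  refine (hη.eq_sharp fun w => ?_).symm
  rw [(hη.reeb_spec x).1, (hη.reeb_spec x).2]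
  ring

lemma eta_sharp (hη : IsContactForm I η) (α : TangentSpace I x →L[ℝ] ℝ) :
    η x (sharp I η x α) = α (reeb I η x) := by
  have h := hη.sharp_spec α (reeb I η x)
  rwa [dForm_swap hη.1, (hη.reeb_spec x).1, (hη.reeb_spec x).2, mul_one, neg_zero, zero_add] at h

/-- The equation defining `♯β` is tested on `♯α`, with `η(♯α) = α(R)`. The result no longer contains
`dη`, which makes bilinearity immediate. -/
lemma contactBivector_eq (hη : IsContactForm I η) (α β : TangentSpace I x →L[ℝ] ℝ) :
    contactBivector I η x α β = β (sharp I η x α) - α (reeb I η x) * β (reeb I η x) := by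
  have h := hη.sharp_spec β (sharp I η x α)
  rw [hη.eta_sharp, hη.eta_sharp] at h
  rw [contactBivector, dForm_swap hη.1]
  linarith

omit [FiniteDimensional ℝ E] in
lemma contactBivector_swap (hη : IsContactForm I η) (α β : TangentSpace I x →L[ℝ] ℝ) :
    contactBivector I η x α β = -contactBivector I η x β α := by
  rw [contactBivector, contactBivector, dForm_swap hη.1]

/-- The contact bivector, as a bilinear map. -/
def bivectorLin (hη : IsContactForm I η) (x : M) :
    (TangentSpace I x →L[ℝ] ℝ) →ₗ[ℝ] (TangentSpace I x →L[ℝ] ℝ) →ₗ[ℝ] ℝ :=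
  LinearMap.mk₂ ℝ (contactBivector I η x)
    (fun α β γ => by simp only [hη.contactBivector_eq, hη.sharp_add, map_add, add_apply]; ring)
    (fun c α β => by
      simp only [hη.contactBivector_eq, hη.sharp_smul, map_smul, smul_apply, smul_eq_mul]; ring)
    (fun α β γ => by simp only [hη.contactBivector_eq, add_apply]; ring)
    (fun c α β => by simp only [hη.contactBivector_eq, smul_apply, smul_eq_mul]; ring)

-- Covectors separate points, so the vector chosen in `sharpBivector` is unique.
omit [FiniteDimensional ℝ E] [IsManifold I ∞ M] [I.Boundaryless] in
lemma eq_of_forall_covector {v w : TangentSpace I x}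
    (h : ∀ β : TangentSpace I x →L[ℝ] ℝ, β v = β w) : v = w :=
  (SeparatingDual.eq_iff_forall_dual_eq (R := ℝ) (V := E)).2 h

lemma sharpBivector_eq (hη : IsContactForm I η) (α : TangentSpace I x →L[ℝ] ℝ) :
    sharpBivector I η x α = sharp I η x α - α (reeb I η x) • reeb I η x := by
  have hs (β : TangentSpace I x →L[ℝ] ℝ) :
      β (sharp I η x α - α (reeb I η x) • reeb I η x) = contactBivector I η x α β := by
    rw [hη.contactBivector_eq, map_sub, map_smul, smul_eq_mul]
  have h := Classical.epsilon_spec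
    (p := fun v => ∀ β : TangentSpace I x →L[ℝ] ℝ, β v = contactBivector I η x α β) ⟨_, hs⟩
  exact eq_of_forall_covector fun β => (h β).trans (hs β).symm

variable {f g h : M → ℝ}

lemma hamField_eq (hη : IsContactForm I η) (f : M → ℝ) (x : M) :
    hamField I η f x =
      sharp I η x (mvfderiv I f x) - (reebDeriv I η f x + f x) • reeb I η x := by
  rw [hamField, hη.sharp_sub, hη.sharp_smul, hη.sharp_eta]

/-- This is the combination occurring in `djReeb`, so that `R_DJ = R + C_{ab} R(φ^b) X_{φ^a}`. -/
lemma sharpBivector_sub_reeb (hη : IsContactForm I η) (f : M → ℝ) (x : M) :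
    sharpBivector I η x (mvfderiv I f x) - f x • reeb I η x = hamField I η f x := by
  rw [hη.hamField_eq, hη.sharpBivector_eq, add_smul, sub_sub]
  rfl

/-- The dictionary between motions and brackets: it turns tangency and evolution into bracket
identities. -/
lemma mvfderiv_hamField (hη : IsContactForm I η) (f g : M → ℝ) (x : M) :
    mvfderiv I g x (hamField I η f x) = bracket I η f g x - g x * reebDeriv I η f x := by
  rw [bracket, hη.contactBivector_eq, hη.hamField_eq, map_sub, map_smul, smul_eq_mul]
  simp only [reebDeriv]
  ring

omit [FiniteDimensional ℝ E] in
lemma bracket_swap (hη : IsContactForm I η) (f g : M → ℝ) (x : M) :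
    bracket I η f g x = -bracket I η g f x := by
  rw [bracket, bracket, hη.contactBivector_swap]
  ring

/-! ### Passage to a chart -/

omit [FiniteDimensional ℝ E] in
lemma fderiv_comp_symm (hx : x ∈ (extChartAt I p).source) (hf : MDifferentiableAt I 𝓘(ℝ, ℝ) f x) :
    fderiv ℝ (f ∘ (extChartAt I p).symm) (extChartAt I p x) =
      (mvfderiv I f x).comp (ofModel I p x) := by
  ext v
  rw [ContinuousLinearMap.comp_apply, mvfderiv_eq_fderiv_chart hx hf, toModel_ofModel hx]

lemma coordReeb_eq (hη : IsContactForm I η) (hx : x ∈ (extChartAt I p).source) :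
    coordReeb (formInChart I η p) (extChartAt I p x) = toModel I p x (reeb I η x) := by
  rw [hη.toModel_eq_inverse hx (α := η x), coordReeb]
  · congr 1
    ext v
    rw [ContinuousLinearMap.comp_apply, ← formInChart_toModel η hx, toModel_ofModel hx]
  · intro w
    rw [(hη.reeb_spec x).1, (hη.reeb_spec x).2]
    ring

lemma fderiv_coordReeb (hη : IsContactForm I η) (hx : x ∈ (extChartAt I p).source)
    (hf : MDifferentiableAt I 𝓘(ℝ, ℝ) f x) :
    fderiv ℝ (f ∘ (extChartAt I p).symm) (extChartAt I p x)
      (coordReeb (formInChart I η p) (extChartAt I p x)) = reebDeriv I η f x := by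
  rw [hη.coordReeb_eq hx, ← mvfderiv_eq_fderiv_chart hx hf]
  rfl

lemma coordHam_eq (hη : IsContactForm I η) (hx : x ∈ (extChartAt I p).source)
    (hf : MDifferentiableAt I 𝓘(ℝ, ℝ) f x) :
    coordHam (formInChart I η p) (f ∘ (extChartAt I p).symm) (extChartAt I p x) =
      toModel I p x (hamField I η f x) := by
  rw [hamField, hη.toModel_eq_inverse hx (hη.sharp_spec _), coordHam, hη.fderiv_coordReeb hx hf,
    fderiv_comp_symm hx hf]
  congr 1
  ext v
  have h1 := formInChart_toModel η hx (ofModel I p x v)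
  rw [toModel_ofModel hx] at h1
  simp [-extChartAt, (extChartAt I p).left_inv hx, h1]

lemma coordBracket_eq (hη : IsContactForm I η) (hx : x ∈ (extChartAt I p).source)
    (hf : MDifferentiableAt I 𝓘(ℝ, ℝ) f x) (hg : MDifferentiableAt I 𝓘(ℝ, ℝ) g x) :
    coordBracket (formInChart I η p) (f ∘ (extChartAt I p).symm) (g ∘ (extChartAt I p).symm)
      (extChartAt I p x) = bracket I η f g x := by
  rw [coordBracket, hη.coordHam_eq hx hf, hη.fderiv_coordReeb hx hf,
    ← mvfderiv_eq_fderiv_chart hx hg, hη.mvfderiv_hamField, Function.comp_apply,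
    (extChartAt I p).left_inv hx]
  ring

end IsContactForm

/-! ### Smoothness of the contact structure, and the Jacobi identity on the manifold -/

section Smooth

variable {U : Set M} {f g h : M → ℝ}

omit [FiniteDimensional ℝ E] [IsManifold I ∞ M] [I.Boundaryless] in
lemma SmoothOn.contMDiffAt (hf : SmoothOn I U f) (hU : IsOpen U) (hx : x ∈ U) :
    ContMDiffAt I 𝓘(ℝ, ℝ) ∞ f x :=
  ContMDiffOn.contMDiffAt hf (hU.mem_nhds hx)

omit [FiniteDimensional ℝ E] [IsManifold I ∞ M] [I.Boundaryless] in
lemma SmoothOn.mdifferentiableAt (hf : SmoothOn I U f) (hU : IsOpen U) (hx : x ∈ U) :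
    MDifferentiableAt I 𝓘(ℝ, ℝ) f x :=
  (hf.contMDiffAt hU hx).mdifferentiableAt (by simp)

omit [FiniteDimensional ℝ E] [I.Boundaryless] in
lemma SmoothOn.contDiffOn_chart (hf : SmoothOn I U f) (p : M) :
    ContDiffOn ℝ ∞ (f ∘ (extChartAt I p).symm)
      ((extChartAt I p).target ∩ (extChartAt I p).symm ⁻¹' U) :=
  contMDiffOn_iff_contDiffOn.1 (ContMDiffOn.comp hf
    ((contMDiffOn_extChartAt_symm p).mono Set.inter_subset_left) fun _ hy => hy.2)

omit [FiniteDimensional ℝ E] [IsManifold I ∞ M] [I.Boundaryless] in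
/-- The points of `U` near `p` that lie in the preferred chart at `p`. -/
lemma eventually_mem_source (hU : IsOpen U) (hp : p ∈ U) :
    ∀ᶠ x in 𝓝 p, x ∈ (extChartAt I p).source ∧ x ∈ U :=
  Filter.Eventually.and
    ((isOpen_extChartAt_source (I := I) p).mem_nhds (mem_extChartAt_source (I := I) p))
    (hU.mem_nhds hp)

omit [FiniteDimensional ℝ E] [IsManifold I ∞ M] in
lemma contMDiffAt_of_chart {F : Type*} [NormedAddCommGroup F] [NormedSpace ℝ F]
    (hU : IsOpen U) (hp : p ∈ U) {k : M → F} {G : E → F}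
    (hG : ContDiffOn ℝ ∞ G ((extChartAt I p).target ∩ (extChartAt I p).symm ⁻¹' U))
    (h : ∀ x ∈ (extChartAt I p).source, x ∈ U → k x = G (extChartAt I p x)) :
    ContMDiffAt I 𝓘(ℝ, F) ∞ k p := by
  have ho := (continuousOn_extChartAt_symm (I := I) p).isOpen_inter_preimage
    (isOpen_extChartAt_target p) hU
  have hm : extChartAt I p p ∈ (extChartAt I p).target ∩ (extChartAt I p).symm ⁻¹' U :=
    ⟨mem_extChartAt_target p, by
      rw [Set.mem_preimage, (extChartAt I p).left_inv (mem_extChartAt_source p)]; exact hp⟩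
  have h1 : ContMDiffAt I 𝓘(ℝ, F) ∞ (G ∘ extChartAt I p) p :=
    ((hG.contDiffAt (ho.mem_nhds hm)).contMDiffAt).comp p contMDiffAt_extChartAt
  refine h1.congr_of_eventuallyEq ?_
  filter_upwards [eventually_mem_source (I := I) hU hp] with x hx
  exact h x hx.1 hx.2

lemma SmoothOn.bracket (hη : IsContactForm I η) (hU : IsOpen U) (hf : SmoothOn I U f)
    (hg : SmoothOn I U g) : SmoothOn I U (bracket I η f g) := fun p hp =>
  (contMDiffAt_of_chart hU hp ((hη.coord p hU).contDiffOn_bracket (hf.contDiffOn_chart p)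
    (hg.contDiffOn_chart p)) fun _ hx hxU => (hη.coordBracket_eq hx (hf.mdifferentiableAt hU hxU)
      (hg.mdifferentiableAt hU hxU)).symm).contMDiffWithinAt

lemma SmoothOn.reebDeriv (hη : IsContactForm I η) (hU : IsOpen U) (hf : SmoothOn I U f) :
    SmoothOn I U (reebDeriv I η f) := fun p hp =>
  (contMDiffAt_of_chart hU hp ((hη.coord p hU).contDiffOn_reebDeriv (hf.contDiffOn_chart p))
    fun _ hx hxU => (hη.fderiv_coordReeb hx (hf.mdifferentiableAt hU hxU)).symm).contMDiffWithinAt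

lemma IsContactForm.smoothFieldOn_reeb (hη : IsContactForm I η) (hU : IsOpen U) :
    SmoothFieldOn I U (reeb I η) := fun p hp => by
  refine smoothFieldWithinAt_iff.2 (ContMDiffAt.contMDiffWithinAt ?_)
  exact contMDiffAt_of_chart hU hp (hη.coord p hU).contDiffOn_reeb
    fun _ hx _ => (hη.coordReeb_eq hx).symm

lemma SmoothOn.smoothFieldOn_hamField (hη : IsContactForm I η) (hU : IsOpen U)
    (hf : SmoothOn I U f) : SmoothFieldOn I U (hamField I η f) := fun p hp => by
  refine smoothFieldWithinAt_iff.2 (ContMDiffAt.contMDiffWithinAt ?_)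
  exact contMDiffAt_of_chart hU hp ((hη.coord p hU).contDiffOn_ham (hf.contDiffOn_chart p))
    fun _ hx hxU => (hη.coordHam_eq hx (hf.mdifferentiableAt hU hxU)).symm

omit [FiniteDimensional ℝ E] in
/-- The derivative of a smooth function along a smooth vector field is smooth. -/
lemma SmoothFieldOn.apply (hU : IsOpen U) {S : Set M} (hS : S ⊆ U) {X : (p : M) → TangentSpace I p}
    (hX : SmoothFieldOn I S X) (hf : SmoothOn I U f) :
    SmoothOn I S (fun q => mvfderiv I f q (X q)) := fun p hp => by
  have h1 : ContMDiffAt I 𝓘(ℝ, E →L[ℝ] ℝ) ∞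
      (fun q => fderiv ℝ (f ∘ (extChartAt I p).symm) (extChartAt I p q)) p :=
    contMDiffAt_of_chart hU (hS hp) ((hf.contDiffOn_chart p).fderiv_of_isOpen
      ((continuousOn_extChartAt_symm p).isOpen_inter_preimage (isOpen_extChartAt_target p) hU)
      (by simp)) fun _ _ _ => rfl
  have h2 := smoothFieldWithinAt_iff.1 (hX p hp)
  have he := eventually_mem_source (I := I) hU (hS hp)
  have he' (q : M) (hq : q ∈ (extChartAt I p).source ∧ q ∈ U) := mvfderiv_eq_fderiv_chart hq.1
    (hf.mdifferentiableAt hU hq.2) (X q)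
  exact (h1.contMDiffWithinAt.clm_apply h2).congr_of_eventuallyEq
    ((he.filter_mono nhdsWithin_le_nhds).mono he') (he' p he.self_of_nhds)

/-- The Jacobi identity for the bracket of a contact manifold. -/
lemma IsContactForm.jacobi (hη : IsContactForm I η) (hU : IsOpen U) (hf : SmoothOn I U f)
    (hg : SmoothOn I U g) (hh : SmoothOn I U h) (hp : p ∈ U) :
    DiracJacobi.bracket I η f (DiracJacobi.bracket I η g h) p
      - DiracJacobi.bracket I η g (DiracJacobi.bracket I η f h) p =
      DiracJacobi.bracket I η (DiracJacobi.bracket I η f g) h p := by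
  have hps := mem_extChartAt_source (I := I) p
  have hC := hη.coord p hU
  have hy : extChartAt I p p ∈ (extChartAt I p).target ∩ (extChartAt I p).symm ⁻¹' U :=
    ⟨mem_extChartAt_target p, by
      rw [Set.mem_preimage, (extChartAt I p).left_inv hps]; exact hp⟩
  -- The inner brackets are differentiated once more, so they must agree with their chart
  -- expressions on a neighbourhood and not only at the point.
  have hc {a b : M → ℝ} (ha : SmoothOn I U a) (hb : SmoothOn I U b) :
      DiracJacobi.bracket I η a b ∘ (extChartAt I p).symm =ᶠ[𝓝 (extChartAt I p p)]
        coordBracket (formInChart I η p) (a ∘ (extChartAt I p).symm)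
          (b ∘ (extChartAt I p).symm) := by
    filter_upwards [hC.isOpen.mem_nhds hy] with y hy
    have hs := (extChartAt I p).map_target hy.1
    rw [Function.comp_apply, ← hη.coordBracket_eq hs (ha.mdifferentiableAt hU hy.2)
      (hb.mdifferentiableAt hU hy.2), (extChartAt I p).right_inv hy.1]
  have ht {a b : M → ℝ} (ha : SmoothOn I U a) (hb : SmoothOn I U b) :=
    (hη.coordBracket_eq hps (ha.mdifferentiableAt hU hp) (hb.mdifferentiableAt hU hp)).symm
  rw [ht hf (hg.bracket hη hU hh), ht hg (hf.bracket hη hU hh), ht (hf.bracket hη hU hg) hh,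
    coordBracket_congr .rfl (hc hg hh), coordBracket_congr .rfl (hc hf hh),
    coordBracket_congr (hc hf hg) .rfl]
  exact hC.jacobi (hf.contDiffOn_chart p) (hg.contDiffOn_chart p) (hh.contDiffOn_chart p) hy

end Smooth

end ContactPointwise

/-! ### Bilinear forms given by a matrix -/

section Pairing

variable {ι : Type*} [Fintype ι]

/-- The bilinear form with a given matrix. -/
def pairing (A : Matrix ι ι ℝ) : (ι → ℝ) →ₗ[ℝ] (ι → ℝ) →ₗ[ℝ] ℝ :=
  LinearMap.mk₂ ℝ (fun u v => ∑ a, ∑ b, u a * A a b * v b)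
    (fun u u' v => by simp only [Pi.add_apply, add_mul, Finset.sum_add_distrib])
    (fun c u v => by simp only [Pi.smul_apply, smul_eq_mul, mul_assoc, Finset.mul_sum])
    (fun u v v' => by simp only [Pi.add_apply, mul_add, Finset.sum_add_distrib])
    (fun c u v => by
      simp only [Pi.smul_apply, smul_eq_mul, Finset.mul_sum]
      exact Finset.sum_congr rfl fun a _ => Finset.sum_congr rfl fun b _ => by ring)

lemma pairing_apply (A : Matrix ι ι ℝ) (u v : ι → ℝ) :
    pairing A u v = ∑ a, ∑ b, u a * A a b * v b := rfl

lemma pairing_swap {A : Matrix ι ι ℝ} (hA : A.transpose = -A) (u v : ι → ℝ) :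
    pairing A u v = -pairing A v u := by
  have h (a b : ι) : A a b = -A b a := by
    simpa using congrFun (congrFun hA b) a
  rw [pairing_apply, Finset.sum_comm, pairing_apply]
  simp only [← Finset.sum_neg_distrib]
  refine Finset.sum_congr rfl fun a _ => Finset.sum_congr rfl fun b _ => ?_
  rw [h b a]
  ring

variable [DecidableEq ι]

/-- The row `A c` is `e_c A`, so `A A⁻¹ = 1` leaves `e_c · v`. This is the algebra behind the
Casimir property. -/
lemma pairing_inv_row {A : Matrix ι ι ℝ} (hA : IsUnit A.det) (c : ι) (v : ι → ℝ) :
    pairing A⁻¹ (A c) v = v c := by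
  have h (b : ι) : ∑ a, A c a * A⁻¹ a b = (1 : Matrix ι ι ℝ) c b := by
    rw [← Matrix.mul_nonsing_inv A hA, Matrix.mul_apply]
  rw [pairing_apply, Finset.sum_comm]
  simp only [← Finset.sum_mul, h, Matrix.one_apply, ite_mul, one_mul, zero_mul,
    Finset.sum_ite_eq, Finset.mem_univ, if_true]

lemma inv_transpose_of_skew {A : Matrix ι ι ℝ} (hA : A.transpose = -A) (hu : IsUnit A.det) :
    A⁻¹.transpose = -A⁻¹ := by
  rw [Matrix.transpose_nonsing_inv, hA]
  exact Matrix.inv_eq_left_inv (by rw [neg_mul_neg, Matrix.nonsing_inv_mul A hu])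

end Pairing

/-! ### Smoothness of the inverse matrix -/

section SmoothMatrix

variable {ι : Type*} [Fintype ι] [DecidableEq ι]

lemma contDiff_det : ContDiff ℝ ∞ (fun B : ι → ι → ℝ => (Matrix.of B).det) := by
  simp only [Matrix.det_apply]
  refine ContDiff.sum fun σ _ => ContDiff.const_smul _ (contDiff_prod fun i _ => ?_)
  exact (contDiff_apply ℝ ℝ i).comp (contDiff_apply ℝ (ι → ℝ) (σ i))

lemma contDiffAt_matrix_inv {B : ι → ι → ℝ} (hB : (Matrix.of B).det ≠ 0) (a b : ι) :
    ContDiffAt ℝ ∞ (fun B : ι → ι → ℝ => (Matrix.of B)⁻¹ a b) B := by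
  -- Cramer's rule: an entry of the inverse is a quotient of determinants, the numerator being that
  -- of the matrix with row `b` replaced by `e_a`.
  have h : (fun B : ι → ι → ℝ => (Matrix.of B)⁻¹ a b) = fun B =>
      (Matrix.of B).det⁻¹ * (Matrix.of (Function.update B b (Pi.single a 1))).det := by
    funext B
    rw [Matrix.inv_def, Ring.inverse_eq_inv', Matrix.smul_apply, Matrix.adjugate_apply, smul_eq_mul]
    rfl
  rw [h]
  refine (contDiff_det.contDiffAt.inv hB).mul (contDiff_det.contDiffAt.comp B ?_)
  refine contDiffAt_pi.2 fun i => ?_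
  by_cases hi : i = b
  · subst hi
    simpa using contDiffAt_const
  · simpa [hi] using (contDiff_apply ℝ (ι → ℝ) i).contDiffAt

variable {E : Type*} [NormedAddCommGroup E] [NormedSpace ℝ E]
  {W : Type*} [TopologicalSpace W] {I : ModelWithCorners ℝ E W}
  {M : Type*} [TopologicalSpace M] [ChartedSpace W M]

lemma contMDiffWithinAt_matrix_inv {A : M → Matrix ι ι ℝ} {S : Set M} {p : M}
    (hA : ∀ a b, ContMDiffWithinAt I 𝓘(ℝ, ℝ) ∞ (fun q => A q a b) S p) (hp : (A p).det ≠ 0)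
    (a b : ι) : ContMDiffWithinAt I 𝓘(ℝ, ℝ) ∞ (fun q => (A q)⁻¹ a b) S p := by
  have h1 : ContMDiffWithinAt I 𝓘(ℝ, ι → ι → ℝ) ∞ (fun q a b => A q a b) S p :=
    contMDiffWithinAt_pi_space.2 fun a => contMDiffWithinAt_pi_space.2 fun b => hA a b
  exact ((contDiffAt_matrix_inv (B := fun a b => A p a b) hp a b).contMDiffAt).comp_contMDiffWithinAt
    p h1

lemma mvfderiv_finset_sum {σ : Type*} (s : Finset σ) {f : σ → M → ℝ} {x : M}
    (hf : ∀ i ∈ s, MDifferentiableAt I 𝓘(ℝ, ℝ) (f i) x) :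
    MDifferentiableAt I 𝓘(ℝ, ℝ) (fun q => ∑ i ∈ s, f i q) x ∧
      mvfderiv I (fun q => ∑ i ∈ s, f i q) x = ∑ i ∈ s, mvfderiv I (f i) x := by
  classical
  induction s using Finset.induction_on with
  | empty => simpa using ⟨mdifferentiableAt_const, mvfderiv_const (0 : ℝ)⟩
  | insert i s hi ih =>
    obtain ⟨h1, h2⟩ := ih fun j hj => hf j (Finset.mem_insert_of_mem hj)
    have h3 := hf i (Finset.mem_insert_self i s)
    simp only [Finset.sum_insert hi]
    exact ⟨h3.add h1, by rw [mvfderiv_fun_add h3 h1, h2]⟩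

omit [DecidableEq ι] in
/-- A product with two vanishing factors has vanishing derivative. -/
lemma mvfderiv_pairing_eq_zero {A : M → Matrix ι ι ℝ} {u v : ι → M → ℝ} {x : M}
    (hA : ∀ a b, MDifferentiableAt I 𝓘(ℝ, ℝ) (fun q => A q a b) x)
    (hu : ∀ a, MDifferentiableAt I 𝓘(ℝ, ℝ) (u a) x) (hv : ∀ a, MDifferentiableAt I 𝓘(ℝ, ℝ) (v a) x)
    (hu0 : ∀ a, u a x = 0) (hv0 : ∀ a, v a x = 0) :
    mvfderiv I (fun q => ∑ a, ∑ b, u a q * A q a b * v b q) x = 0 := by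
  have h1 (a b : ι) : MDifferentiableAt I 𝓘(ℝ, ℝ) (fun q => u a q * A q a b) x :=
    (hu a).mul (hA a b)
  have h2 (a b : ι) : MDifferentiableAt I 𝓘(ℝ, ℝ) (fun q => u a q * A q a b * v b q) x :=
    (h1 a b).mul (hv b)
  rw [(mvfderiv_finset_sum _ fun a _ => (mvfderiv_finset_sum _ fun b _ => h2 a b).1).2]
  refine Finset.sum_eq_zero fun a _ => ?_
  rw [(mvfderiv_finset_sum _ fun b _ => h2 a b).2]
  refine Finset.sum_eq_zero fun b _ => ?_
  rw [mvfderiv_fun_mul (h1 a b) (hv b), hu0, hv0]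
  simp

end SmoothMatrix

/-! ### From the Jacobi identity to a Jacobi structure -/

section JacobiStructure

variable {E : Type*} [NormedAddCommGroup E] [NormedSpace ℝ E]
  {W : Type*} [TopologicalSpace W] {I : ModelWithCorners ℝ E W}
  {M : Type*} [TopologicalSpace M] [ChartedSpace W M]
  {U : Set M}
  {Λ : (p : M) → (TangentSpace I p →L[ℝ] ℝ) →ₗ[ℝ] (TangentSpace I p →L[ℝ] ℝ) →ₗ[ℝ] ℝ}
  {V : (p : M) → TangentSpace I p} {br : (M → ℝ) → (M → ℝ) → M → ℝ} {f g h : M → ℝ} {p : M}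

lemma mvfderiv_congr_on (hU : IsOpen U) (hp : p ∈ U) (h : ∀ q ∈ U, f q = g q) :
    mvfderiv I f p = mvfderiv I g p := by
  have : f =ᶠ[𝓝 p] g := Filter.eventuallyEq_of_mem (hU.mem_nhds hp) h
  ext v
  exact DFunLike.congr_fun (this.mfderiv_eq (I := I) (I' := 𝓘(ℝ, ℝ))) v

/-- The identities of a Jacobi structure follow from the Jacobi identity of its bracket. -/
lemma jacobiStructure_of_jacobi (hU : IsOpen U)
    (hbr : ∀ f g : M → ℝ, SmoothOn I U f → SmoothOn I U g → ∀ p ∈ U,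
      br f g p = Λ p (mvfderiv I f p) (mvfderiv I g p)
        + f p * mvfderiv I g p (V p) - g p * mvfderiv I f p (V p))
    (hΛ : ∀ f g : M → ℝ, SmoothOn I U f → SmoothOn I U g →
      SmoothOn I U (fun p => Λ p (mvfderiv I f p) (mvfderiv I g p)))
    (hV : ∀ f : M → ℝ, SmoothOn I U f → SmoothOn I U (fun p => mvfderiv I f p (V p)))
    (hsm : ∀ f g : M → ℝ, SmoothOn I U f → SmoothOn I U g → SmoothOn I U (br f g))
    (hskew : ∀ p ∈ U, ∀ α β, Λ p α β = -Λ p β α)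
    (hj : ∀ f g h : M → ℝ, SmoothOn I U f → SmoothOn I U g → SmoothOn I U h → ∀ p ∈ U,
      br f (br g h) p + br g (br h f) p + br h (br f g) p = 0) :
    (∀ f g : M → ℝ, SmoothOn I U f → SmoothOn I U g → ∀ p ∈ U,
      mvfderiv I (fun q => Λ q (mvfderiv I f q) (mvfderiv I g q)) p (V p)
        - Λ p (mvfderiv I (fun q => mvfderiv I f q (V q)) p) (mvfderiv I g p)
        - Λ p (mvfderiv I f p) (mvfderiv I (fun q => mvfderiv I g q (V q)) p) = 0) ∧
    ∀ f g h : M → ℝ, SmoothOn I U f → SmoothOn I U g → SmoothOn I U h → ∀ p ∈ U,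
      Λ p (mvfderiv I (fun q => Λ q (mvfderiv I f q) (mvfderiv I g q)) p) (mvfderiv I h p)
        + Λ p (mvfderiv I (fun q => Λ q (mvfderiv I g q) (mvfderiv I h q)) p) (mvfderiv I f p)
        + Λ p (mvfderiv I (fun q => Λ q (mvfderiv I h q) (mvfderiv I f q)) p) (mvfderiv I g p)
      = mvfderiv I f p (V p) * Λ p (mvfderiv I g p) (mvfderiv I h p)
        + mvfderiv I g p (V p) * Λ p (mvfderiv I h p) (mvfderiv I f p)
        + mvfderiv I h p (V p) * Λ p (mvfderiv I f p) (mvfderiv I g p) := by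
  have hd {a b : M → ℝ} (ha : SmoothOn I U a) (hb : SmoothOn I U b) {p : M} (hp : p ∈ U) :
      mvfderiv I (br a b) p = mvfderiv I (fun q => Λ q (mvfderiv I a q) (mvfderiv I b q)) p
        + (a p • mvfderiv I (fun q => mvfderiv I b q (V q)) p
          + mvfderiv I b p (V p) • mvfderiv I a p)
        - (b p • mvfderiv I (fun q => mvfderiv I a q (V q)) p
          + mvfderiv I a p (V p) • mvfderiv I b p) := by
    have d {k : M → ℝ} (hk : SmoothOn I U k) := hk.mdifferentiableAt hU hp
    have h1 : MDifferentiableAt I 𝓘(ℝ, ℝ) (fun q => a q * mvfderiv I b q (V q)) p :=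
      (d ha).mul (d (hV b hb))
    have h2 : MDifferentiableAt I 𝓘(ℝ, ℝ) (fun q => b q * mvfderiv I a q (V q)) p :=
      (d hb).mul (d (hV a ha))
    have h3 : MDifferentiableAt I 𝓘(ℝ, ℝ)
        (fun q => Λ q (mvfderiv I a q) (mvfderiv I b q) + a q * mvfderiv I b q (V q)) p :=
      (d (hΛ a b ha hb)).add h1
    rw [mvfderiv_congr_on hU hp (hbr a b ha hb), mvfderiv_fun_sub h3 h2,
      mvfderiv_fun_add (d (hΛ a b ha hb)) h1, mvfderiv_fun_mul (d ha) (d (hV b hb)),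
      mvfderiv_fun_mul (d hb) (d (hV a ha))]
  -- The third function is taken to be the constant `1`: since `{f, 1} = -V(f)`, the Jacobi identity
  -- for `f, g, 1` is `L_V Λ = 0`.
  have hlie : ∀ f g : M → ℝ, SmoothOn I U f → SmoothOn I U g → ∀ p ∈ U,
      mvfderiv I (fun q => Λ q (mvfderiv I f q) (mvfderiv I g q)) p (V p)
        - Λ p (mvfderiv I (fun q => mvfderiv I f q (V q)) p) (mvfderiv I g p)
        - Λ p (mvfderiv I f p) (mvfderiv I (fun q => mvfderiv I g q (V q)) p) = 0 := by
    intro f g hf hg p hp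
    have h1 : SmoothOn I U (fun _ : M => (1 : ℝ)) := contMDiffOn_const
    have hz (q : M) : mvfderiv I (fun _ : M => (1 : ℝ)) q = 0 := mvfderiv_const 1
    have hz' : mvfderiv I (fun q => mvfderiv I (fun _ : M => (1 : ℝ)) q (V q)) p = 0 := by
      simp only [hz, zero_apply]
      exact mvfderiv_const 0
    have hz1 : mvfderiv I (fun q => Λ q (mvfderiv I g q) (mvfderiv I (fun _ : M => (1 : ℝ)) q)) p
        = 0 := by
      simp only [hz, map_zero]
      exact mvfderiv_const 0
    have hz2 : mvfderiv I (fun q => Λ q (mvfderiv I (fun _ : M => (1 : ℝ)) q) (mvfderiv I f q)) p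
        = 0 := by
      simp only [hz, map_zero, LinearMap.zero_apply]
      exact mvfderiv_const 0
    have key := hj f g _ hf hg h1 p hp
    rw [hbr _ _ hf (hsm _ _ hg h1) p hp, hbr _ _ hg (hsm _ _ h1 hf) p hp,
      hbr _ _ h1 (hsm _ _ hf hg) p hp, hd hg h1 hp, hd h1 hf hp, hd hf hg hp,
      hbr _ _ hg h1 p hp, hbr _ _ h1 hf p hp, hbr _ _ hf hg p hp, hz, hz', hz1, hz2] at key
    simp only [map_add, map_sub, map_smul, map_zero, smul_zero, add_apply, sub_apply, smul_apply,
      zero_apply, LinearMap.zero_apply, smul_eq_mul] at key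
    have hs := hskew p hp (mvfderiv I (fun q => mvfderiv I f q (V q)) p) (mvfderiv I g p)
    linarith
  refine ⟨hlie, fun f g h hf hg hh p hp => ?_⟩
  have key := hj f g h hf hg hh p hp
  have l1 := hlie f g hf hg p hp
  have l2 := hlie g h hg hh p hp
  have l3 := hlie h f hh hf p hp
  rw [hbr _ _ hf (hsm _ _ hg hh) p hp, hbr _ _ hg (hsm _ _ hh hf) p hp,
    hbr _ _ hh (hsm _ _ hf hg) p hp, hd hg hh hp, hd hh hf hp, hd hf hg hp,
    hbr _ _ hg hh p hp, hbr _ _ hh hf p hp, hbr _ _ hf hg p hp] at key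
  simp only [map_add, map_sub, map_smul, add_apply, sub_apply, smul_apply, smul_eq_mul] at key
  -- In the Jacobi identity for `f, g, h` the terms containing an undifferentiated function are
  -- multiples of the identities `L_V Λ = 0` already proved; removing them leaves the Schouten
  -- identity.
  have m1 := congrArg (h p * ·) l1
  have m2 := congrArg (f p * ·) l2
  have m3 := congrArg (g p * ·) l3
  have t1 := congrArg (h p * ·)
    (hskew p hp (mvfderiv I (fun q => mvfderiv I f q (V q)) p) (mvfderiv I g p))
  have t2 := congrArg (f p * ·)
    (hskew p hp (mvfderiv I (fun q => mvfderiv I g q (V q)) p) (mvfderiv I h p))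
  have t3 := congrArg (g p * ·)
    (hskew p hp (mvfderiv I (fun q => mvfderiv I h q (V q)) p) (mvfderiv I f p))
  have s1 := congrArg (mvfderiv I h p (V p) * ·) (hskew p hp (mvfderiv I f p) (mvfderiv I g p))
  have s2 := congrArg (mvfderiv I f p (V p) * ·) (hskew p hp (mvfderiv I g p) (mvfderiv I h p))
  have s3 := congrArg (mvfderiv I g p (V p) * ·) (hskew p hp (mvfderiv I h p) (mvfderiv I f p))
  rw [hskew p hp _ (mvfderiv I f p), hskew p hp _ (mvfderiv I g p), hskew p hp _ (mvfderiv I h p)]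
  linarith

end JacobiStructure

/-! ### The Dirac-Jacobi bracket -/

section DiracBracket

variable {E : Type*} [NormedAddCommGroup E] [NormedSpace ℝ E] [FiniteDimensional ℝ E]
  {W : Type*} [TopologicalSpace W] {I : ModelWithCorners ℝ E W}
  {M : Type*} [TopologicalSpace M] [ChartedSpace W M]
  [IsManifold I ∞ M] [I.Boundaryless]
  {η : (p : M) → TangentSpace I p →L[ℝ] ℝ} {p : M} {U : Set M} {f g h : M → ℝ}

/-! ### Algebra of the contact bracket -/

lemma IsContactForm.bracket_eq (hη : IsContactForm I η) (f g : M → ℝ) (p : M) :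
    bracket I η f g p = hη.bivectorLin p (mvfderiv I f p) (mvfderiv I g p)
      - f p * mvfderiv I g p (reeb I η p) + g p * mvfderiv I f p (reeb I η p) := rfl

lemma IsContactForm.bracket_add_right (hη : IsContactForm I η)
    (hf : MDifferentiableAt I 𝓘(ℝ, ℝ) f p) (hg : MDifferentiableAt I 𝓘(ℝ, ℝ) g p) :
    bracket I η h (f + g) p = bracket I η h f p + bracket I η h g p := by
  simp only [hη.bracket_eq, mvfderiv_add hf hg, map_add, add_apply, Pi.add_apply]
  ring

lemma IsContactForm.bracket_smul_right (hη : IsContactForm I η) (c : ℝ)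
    (hf : MDifferentiableAt I 𝓘(ℝ, ℝ) f p) :
    bracket I η h (c • f) p = c * bracket I η h f p := by
  have hd : mvfderiv I (c • f) p = c • mvfderiv I f p := by
    have h1 := mvfderiv_smul (I := I) (a := fun _ : M => c) mdifferentiableAt_const hf
    rw [mvfderiv_const] at h1
    refine h1.trans ?_
    ext v
    simp
  simp only [hη.bracket_eq, hd, map_smul, smul_apply, Pi.smul_apply, smul_eq_mul]
  ring

lemma IsContactForm.bracket_sum_right (hη : IsContactForm I η) {ι : Type*} (s : Finset ι)
    {k : ι → M → ℝ} (c : ι → ℝ) (hk : ∀ i, MDifferentiableAt I 𝓘(ℝ, ℝ) (k i) p) :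
    bracket I η h (fun q => ∑ i ∈ s, c i * k i q) p = ∑ i ∈ s, c i * bracket I η h (k i) p := by
  classical
  have hd (i : ι) : MDifferentiableAt I 𝓘(ℝ, ℝ) (fun q => c i * k i q) p :=
    mdifferentiableAt_const.mul (hk i)
  induction s using Finset.induction_on with
  | empty =>
    simp only [Finset.sum_empty, hη.bracket_eq, mvfderiv_const, map_zero, zero_apply]
    ring
  | insert i s hi ih =>
    simp only [Finset.sum_insert hi]
    rw [← ih, ← hη.bracket_smul_right (c i) (hk i)]
    exact hη.bracket_add_right (hd i) (mvfderiv_finset_sum s fun j _ => hd j).1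

/-- The sum `f {g, h} + g {f, h}` contains `-f g R(h)` twice, the bracket on the left only once; the
last term compensates. -/
lemma IsContactForm.bracket_mul_left (hη : IsContactForm I η)
    (hf : MDifferentiableAt I 𝓘(ℝ, ℝ) f p) (hg : MDifferentiableAt I 𝓘(ℝ, ℝ) g p) :
    bracket I η (f * g) h p = f p * bracket I η g h p + g p * bracket I η f h p
      + f p * g p * reebDeriv I η h p := by
  simp only [hη.bracket_eq, mvfderiv_mul hf hg, map_add, map_smul, add_apply, smul_apply,
    LinearMap.add_apply, LinearMap.smul_apply, Pi.mul_apply, smul_eq_mul, reebDeriv]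
  ring

omit [FiniteDimensional ℝ E] [IsManifold I ∞ M] [I.Boundaryless] in
lemma bracket_congr_right (hU : IsOpen U) (hp : p ∈ U) (h' : ∀ q ∈ U, f q = g q) :
    bracket I η h f p = bracket I η h g p := by
  simp only [bracket, reebDeriv, mvfderiv_congr_on hU hp h', h' p hp]

lemma IsContactForm.jacobi_cyclic (hη : IsContactForm I η) (hU : IsOpen U) (hf : SmoothOn I U f)
    (hg : SmoothOn I U g) (hh : SmoothOn I U h) (hp : p ∈ U) :
    bracket I η f (bracket I η g h) p + bracket I η g (bracket I η h f) p
      + bracket I η h (bracket I η f g) p = 0 := by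
  have h1 := hη.jacobi hU hf hg hh hp
  have h2 : bracket I η g (bracket I η h f) p = -bracket I η g (bracket I η f h) p := by
    rw [bracket_congr_right (g := (-1 : ℝ) • bracket I η f h) hU hp fun q _ => by
      simp [hη.bracket_swap h f], hη.bracket_smul_right _
        ((hf.bracket hη hU hh).mdifferentiableAt hU hp)]
    ring
  rw [h2, hη.bracket_swap h]
  linarith

/-! ### Algebra of the Dirac-Jacobi bracket -/

variable {ι : Type*} [Fintype ι] [DecidableEq ι] {φ : ι → M → ℝ}

omit [FiniteDimensional ℝ E] [Fintype ι] [DecidableEq ι] in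
lemma IsContactForm.bracketMatrix_transpose (hη : IsContactForm I η) (φ : ι → M → ℝ) (p : M) :
    (bracketMatrix I η φ p).transpose = -bracketMatrix I η φ p := by
  ext a b
  exact hη.bracket_swap (φ b) (φ a) p

omit [FiniteDimensional ℝ E] [IsManifold I ∞ M] [I.Boundaryless] in
lemma djBracket_eq (f g : M → ℝ) (p : M) : djBracket I η φ f g p = bracket I η f g p
    - pairing (bracketMatrix I η φ p)⁻¹ (fun a => bracket I η f (φ a) p)
      (fun b => bracket I η (φ b) g p) := rfl

omit [FiniteDimensional ℝ E] in
lemma IsContactForm.djBracket_eq' (hη : IsContactForm I η) (f g : M → ℝ) (p : M) :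
    djBracket I η φ f g p = bracket I η f g p
      + pairing (bracketMatrix I η φ p)⁻¹ (fun a => bracket I η f (φ a) p)
      (fun b => bracket I η g (φ b) p) := by
  have : (fun b => bracket I η (φ b) g p) = -fun b => bracket I η g (φ b) p :=
    funext fun b => hη.bracket_swap (φ b) g p
  rw [djBracket_eq, this, map_neg, sub_neg_eq_add]

omit [FiniteDimensional ℝ E] in
lemma IsContactForm.inv_skew (hη : IsContactForm I η)
    (hC : IsUnit (bracketMatrix I η φ p).det) (u v : ι → ℝ) :
    pairing (bracketMatrix I η φ p)⁻¹ u v = -pairing (bracketMatrix I η φ p)⁻¹ v u :=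
  pairing_swap (inv_transpose_of_skew (hη.bracketMatrix_transpose φ p) hC) u v

/-- With `R_DJ = R + C_{ab} R(φ^b) X_{φ^a}`, the derivative `X_{φ^a}(g)` contributes `{φ^a, g}` and
`-g R(φ^a)`; the latter contributes nothing because `C⁻¹` is skew. -/
lemma IsContactForm.djReebDeriv_eq (hη : IsContactForm I η)
    (hC : IsUnit (bracketMatrix I η φ p).det) (g : M → ℝ) :
    djReebDeriv I η φ g p = reebDeriv I η g p
      + pairing (bracketMatrix I η φ p)⁻¹ (fun a => reebDeriv I η (φ a) p)
        (fun b => bracket I η g (φ b) p) := by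
  have h1 : djReebDeriv I η φ g p = reebDeriv I η g p + pairing (bracketMatrix I η φ p)⁻¹
      ((-fun a => bracket I η g (φ a) p) - g p • fun a => reebDeriv I η (φ a) p)
      (fun a => reebDeriv I η (φ a) p) := by
    simp only [djReebDeriv, djReeb, hη.sharpBivector_sub_reeb, map_add, map_sum, map_smul,
      hη.mvfderiv_hamField, smul_eq_mul, pairing_apply]
    congr 1
    refine Finset.sum_congr rfl fun a _ => Finset.sum_congr rfl fun b _ => ?_
    simp only [Pi.sub_apply, Pi.neg_apply, Pi.smul_apply, smul_eq_mul, hη.bracket_swap (φ a) g]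
    ring
  have h2 := hη.inv_skew hC (fun a => reebDeriv I η (φ a) p) (fun a => reebDeriv I η (φ a) p)
  rw [h1, map_sub, map_neg, map_smul, LinearMap.sub_apply, LinearMap.neg_apply,
    LinearMap.smul_apply, smul_eq_mul, hη.inv_skew hC (fun a => bracket I η g (φ a) p)]
  have h3 : pairing (bracketMatrix I η φ p)⁻¹ (fun a => reebDeriv I η (φ a) p)
    (fun a => reebDeriv I η (φ a) p) = 0 := by linarith
  rw [h3]
  ring

omit [FiniteDimensional ℝ E] in
lemma IsContactForm.djBracket_swap (hη : IsContactForm I η)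
    (hC : IsUnit (bracketMatrix I η φ p).det) (f g : M → ℝ) :
    djBracket I η φ f g p = -djBracket I η φ g f p := by
  rw [hη.djBracket_eq', hη.djBracket_eq', hη.bracket_swap f g, hη.inv_skew hC]
  ring

omit [FiniteDimensional ℝ E] [IsManifold I ∞ M] [I.Boundaryless] in
/-- The second class constraints are Casimir functions. -/
lemma djBracket_constraint (hC : IsUnit (bracketMatrix I η φ p).det) (a : ι) (g : M → ℝ) :
    djBracket I η φ (φ a) g p = 0 := by
  have h := pairing_inv_row hC a (fun b => bracket I η (φ b) g p)
  exact (congrArg (bracket I η (φ a) g p - ·) h).trans (sub_self _)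

/-- The contact Leibniz rule is applied both to `{f g, h}` and to each `{f g, φ^a}`; the extra
terms, paired with `{h, φ^b}`, assemble into `R_DJ(h)` by `djReebDeriv_eq`. -/
lemma IsContactForm.djBracket_leibniz (hη : IsContactForm I η)
    (hC : IsUnit (bracketMatrix I η φ p).det)
    (hf : MDifferentiableAt I 𝓘(ℝ, ℝ) f p) (hg : MDifferentiableAt I 𝓘(ℝ, ℝ) g p) :
    djBracket I η φ (f * g) h p = f p * djBracket I η φ g h p + g p * djBracket I η φ f h p
      + f p * g p * djReebDeriv I η φ h p := by
  have h1 : (fun a => bracket I η (f * g) (φ a) p) =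
      f p • (fun a => bracket I η g (φ a) p) + g p • (fun a => bracket I η f (φ a) p)
        + (f p * g p) • fun a => reebDeriv I η (φ a) p :=
    funext fun a => hη.bracket_mul_left hf hg
  rw [hη.djBracket_eq', hη.djBracket_eq', hη.djBracket_eq', h1, hη.djReebDeriv_eq hC,
    hη.bracket_mul_left hf hg]
  simp only [map_add, map_smul, LinearMap.add_apply, LinearMap.smul_apply, smul_eq_mul]
  ring

/-! ### The bivector of the Dirac-Jacobi bracket -/

/-- The linear form `α ↦ Λ(α, dφ) + φ α(R)`. -/
def IsContactForm.constraintForm (hη : IsContactForm I η) (k : M → ℝ) (p : M) :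
    (TangentSpace I p →L[ℝ] ℝ) →ₗ[ℝ] ℝ :=
  (hη.bivectorLin p).flip (mvfderiv I k p)
    + k p • (LinearMap.applyₗ (reeb I η p) ∘ₗ ContinuousLinearMap.coeLM ℝ)

lemma IsContactForm.bracket_eq_constraintForm (hη : IsContactForm I η) (f k : M → ℝ) (p : M) :
    bracket I η f k p =
      hη.constraintForm k p (mvfderiv I f p) - f p * reebDeriv I η k p := by
  rw [hη.bracket_eq]
  simp [constraintForm, reebDeriv]
  ring

/-- The bivector `Λ_DJ`. -/
def IsContactForm.djBivector (hη : IsContactForm I η) (φ : ι → M → ℝ) (p : M) :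
    (TangentSpace I p →L[ℝ] ℝ) →ₗ[ℝ] (TangentSpace I p →L[ℝ] ℝ) →ₗ[ℝ] ℝ :=
  hη.bivectorLin p + (pairing (bracketMatrix I η φ p)⁻¹).compl₁₂
    (LinearMap.pi fun a => hη.constraintForm (φ a) p)
    (LinearMap.pi fun a => hη.constraintForm (φ a) p)

lemma IsContactForm.djBivector_apply (hη : IsContactForm I η)
    (α β : TangentSpace I p →L[ℝ] ℝ) :
    hη.djBivector φ p α β = contactBivector I η p α β
      + pairing (bracketMatrix I η φ p)⁻¹ (fun a => hη.constraintForm (φ a) p α)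
        (fun a => hη.constraintForm (φ a) p β) := rfl

lemma IsContactForm.djBivector_swap (hη : IsContactForm I η)
    (hC : IsUnit (bracketMatrix I η φ p).det) (α β : TangentSpace I p →L[ℝ] ℝ) :
    hη.djBivector φ p α β = -hη.djBivector φ p β α := by
  rw [hη.djBivector_apply, hη.djBivector_apply, hη.contactBivector_swap, hη.inv_skew hC]
  ring

/-- Each `{k, φ^a}` splits into a part linear in `dk` and the part `-k R(φ^a)`. In the correction
term the product of the linear parts belongs to `Λ_DJ`, the mixed products correct `R` to `R_DJ`,
and the product of the remaining parts vanishes by skew-symmetry. -/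
lemma IsContactForm.djBracket_eq_djBivector (hη : IsContactForm I η)
    (hC : IsUnit (bracketMatrix I η φ p).det) (f g : M → ℝ) :
    djBracket I η φ f g p = hη.djBivector φ p (mvfderiv I f p) (mvfderiv I g p)
      - f p * djReebDeriv I η φ g p + g p * djReebDeriv I η φ f p := by
  have h1 (k : M → ℝ) : (fun a => bracket I η k (φ a) p) =
      (fun a => hη.constraintForm (φ a) p (mvfderiv I k p))
        - k p • (fun a => reebDeriv I η (φ a) p) :=
    funext fun a => hη.bracket_eq_constraintForm k (φ a) p
  have h2 := hη.inv_skew hC (fun a => reebDeriv I η (φ a) p) (fun a => reebDeriv I η (φ a) p)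
  have h3 := hη.inv_skew hC (fun a => hη.constraintForm (φ a) p (mvfderiv I f p))
    (fun a => reebDeriv I η (φ a) p)
  have h4 : pairing (bracketMatrix I η φ p)⁻¹ (fun a => reebDeriv I η (φ a) p)
    (fun a => reebDeriv I η (φ a) p) = 0 := by linarith
  rw [hη.djBracket_eq', hη.djReebDeriv_eq hC, hη.djReebDeriv_eq hC, hη.djBivector_apply, bracket,
    h1, h1]
  simp only [map_sub, map_smul, LinearMap.sub_apply, LinearMap.smul_apply, smul_eq_mul, h3, h4]
  ring

/-! ### Smoothness -/

lemma SmoothOn.bracketMatrix_inv (hη : IsContactForm I η) (hU : IsOpen U)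
    (hφ : ∀ a, SmoothOn I U (φ a)) (hC : ∀ p ∈ U, IsUnit (bracketMatrix I η φ p).det) (a b : ι) :
    SmoothOn I U (fun p => (bracketMatrix I η φ p)⁻¹ a b) := fun p hp =>
  contMDiffWithinAt_matrix_inv (fun a b => (hφ a).bracket hη hU (hφ b) p hp) (hC p hp).ne_zero a b

lemma SmoothOn.djBracket (hη : IsContactForm I η) (hU : IsOpen U)
    (hφ : ∀ a, SmoothOn I U (φ a)) (hC : ∀ p ∈ U, IsUnit (bracketMatrix I η φ p).det)
    (hf : SmoothOn I U f) (hg : SmoothOn I U g) : SmoothOn I U (djBracket I η φ f g) := by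
  refine ContMDiffOn.sub (hf.bracket hη hU hg) ?_
  refine contMDiffOn_finsetSum fun a _ => contMDiffOn_finsetSum fun b _ => ?_
  exact ContMDiffOn.mul (ContMDiffOn.mul (hf.bracket hη hU (hφ a))
    (SmoothOn.bracketMatrix_inv hη hU hφ hC a b)) ((hφ b).bracket hη hU hg)

lemma smoothFieldOn_djReeb (hη : IsContactForm I η) (hU : IsOpen U)
    (hφ : ∀ a, SmoothOn I U (φ a)) (hC : ∀ p ∈ U, IsUnit (bracketMatrix I η φ p).det) :
    SmoothFieldOn I U (djReeb I η φ) := fun p hp => by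
  refine smoothFieldWithinAt_iff.2 ?_
  simp only [djReeb, hη.sharpBivector_sub_reeb, map_add, map_sum, map_smul]
  refine ContMDiffWithinAt.add (smoothFieldWithinAt_iff.1 (hη.smoothFieldOn_reeb hU p hp)) ?_
  refine contMDiffWithinAt_finsetSum fun a _ => contMDiffWithinAt_finsetSum fun b _ => ?_
  exact ContMDiffWithinAt.smul (ContMDiffWithinAt.mul
    (SmoothOn.bracketMatrix_inv hη hU hφ hC a b p hp) ((hφ b).reebDeriv hη hU p hp))
    (smoothFieldWithinAt_iff.1 ((hφ a).smoothFieldOn_hamField hη hU p hp))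

/-! ### The Jacobi identity -/

omit [FiniteDimensional ℝ E] [IsManifold I ∞ M] [I.Boundaryless] in
lemma djBracket_congr_right (hU : IsOpen U) (hp : p ∈ U) (h' : ∀ q ∈ U, f q = g q) :
    djBracket I η φ h f p = djBracket I η φ h g p := by
  simp only [djBracket, bracket_congr_right hU hp h']

/-- Adding constant multiples of the constraints does not change the Dirac-Jacobi bracket. -/
lemma IsContactForm.djBracket_add_constraints (hη : IsContactForm I η)
    (hC : IsUnit (bracketMatrix I η φ p).det) (hf : MDifferentiableAt I 𝓘(ℝ, ℝ) f p)
    (hφ : ∀ a, MDifferentiableAt I 𝓘(ℝ, ℝ) (φ a) p) (c : ι → ℝ) (g : M → ℝ) :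
    djBracket I η φ (f + fun q => ∑ a, c a * φ a q) g p = djBracket I η φ f g p := by
  have hd : MDifferentiableAt I 𝓘(ℝ, ℝ) (fun q => ∑ a, c a * φ a q) p :=
    (mvfderiv_finset_sum _ fun a _ => mdifferentiableAt_const.mul (hφ a)).1
  have h1 (k : M → ℝ) : bracket I η k (f + fun q => ∑ a, c a * φ a q) p =
      bracket I η k f p + ∑ a, c a * bracket I η k (φ a) p := by
    rw [hη.bracket_add_right hf hd, hη.bracket_sum_right _ c hφ]
  have h2 : (fun b => bracket I η (φ b) (f + fun q => ∑ a, c a * φ a q) p) =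
      (fun b => bracket I η (φ b) f p) + ∑ a, c a • fun b => bracket I η (φ b) (φ a) p := by
    funext b
    simp [h1]
  have h3 (a : ι) : djBracket I η φ g (φ a) p = 0 := by
    rw [hη.djBracket_swap hC, djBracket_constraint hC, neg_zero]
  rw [hη.djBracket_swap hC, hη.djBracket_swap hC f, neg_inj, djBracket_eq, h1, h2, map_add, map_sum]
  simp only [map_smul, smul_eq_mul]
  rw [djBracket_eq, add_sub_add_comm, ← Finset.sum_sub_distrib]
  simp only [← mul_sub]
  exact add_eq_left.2 (Finset.sum_eq_zero fun a _ => mul_eq_zero_of_right _ (h3 a))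

/-- Adding constant multiples of the constraints makes the brackets with the constraints vanish
at a given point. -/
lemma exists_adapted (hη : IsContactForm I η) (hU : IsOpen U)
    (hφ : ∀ a, SmoothOn I U (φ a)) (hC : ∀ p ∈ U, IsUnit (bracketMatrix I η φ p).det)
    (hf : SmoothOn I U f) (hp : p ∈ U) :
    ∃ f' : M → ℝ, SmoothOn I U f' ∧ (∀ a, bracket I η f' (φ a) p = 0) ∧
      ∀ g, ∀ q ∈ U, djBracket I η φ f' g q = djBracket I η φ f g q := by
  let F : ι → ℝ := fun b => bracket I η f (φ b) p
  -- The solution of `F + c C(p) = 0`, which says that `f + c_a φ^a` has vanishing brackets with the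
  -- constraints at `p`. The coefficients are constants, frozen at `p`.
  let c : ι → ℝ := -Matrix.vecMul F (bracketMatrix I η φ p)⁻¹
  have hs : SmoothOn I U (fun q => ∑ a, c a * φ a q) :=
    contMDiffOn_finsetSum fun a _ => ContMDiffOn.mul contMDiffOn_const (hφ a)
  have hφ' (q : M) (hq : q ∈ U) (a : ι) := (hφ a).mdifferentiableAt hU hq
  refine ⟨f + fun q => ∑ a, c a * φ a q, ContMDiffOn.add hf hs, fun d => ?_, fun g q hq =>
    hη.djBracket_add_constraints (hC q hq) (hf.mdifferentiableAt hU hq) (hφ' q hq) c g⟩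
  have h1 : Matrix.vecMul c (bracketMatrix I η φ p) d = -F d := by
    rw [Matrix.neg_vecMul, Matrix.vecMul_vecMul, Matrix.nonsing_inv_mul _ (hC p hp),
      Matrix.vecMul_one, Pi.neg_apply]
  have h2 : ∑ a, c a * bracket I η (φ a) (φ d) p = -F d := h1
  rw [hη.bracket_swap, hη.bracket_add_right (hf.mdifferentiableAt hU hp)
    (hs.mdifferentiableAt hU hp), hη.bracket_sum_right _ c (hφ' p hp)]
  have h3 : ∑ a, c a * bracket I η (φ d) (φ a) p = F d := by
    rw [← neg_inj, ← h2, ← Finset.sum_neg_distrib]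
    refine Finset.sum_congr rfl fun a _ => ?_
    rw [hη.bracket_swap (φ a) (φ d)]
    ring
  rw [h3, hη.bracket_swap (φ d) f]
  simp [F]

/-- The inner correction `{g, φ^a} C_{ab} {φ^b, h}` has two factors vanishing at `p`, so it affects
neither the value nor the differential there; the outer correction vanishes because of `f`. A
bracket at `p` sees only values and differentials. -/
lemma djBracket_djBracket_of_adapted (hη : IsContactForm I η) (hU : IsOpen U)
    (hφ : ∀ a, SmoothOn I U (φ a)) (hC : ∀ p ∈ U, IsUnit (bracketMatrix I η φ p).det)
    (hg : SmoothOn I U g) (hh : SmoothOn I U h) (hp : p ∈ U)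
    (hf0 : ∀ a, bracket I η f (φ a) p = 0) (hg0 : ∀ a, bracket I η g (φ a) p = 0)
    (hh0 : ∀ a, bracket I η h (φ a) p = 0) :
    djBracket I η φ f (djBracket I η φ g h) p = bracket I η f (bracket I η g h) p := by
  have z {k : M → ℝ} (hk : ∀ a, bracket I η k (φ a) p = 0) :
      (fun a => bracket I η k (φ a) p) = 0 := funext hk
  have hh0' (a : ι) : bracket I η (φ a) h p = 0 := by rw [hη.bracket_swap, hh0, neg_zero]
  have hv : djBracket I η φ g h p = bracket I η g h p := by
    rw [djBracket_eq, z hg0, map_zero, LinearMap.zero_apply, sub_zero]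
  have d {k : M → ℝ} (hk : SmoothOn I U k) := hk.mdifferentiableAt hU hp
  have hS : SmoothOn I U (fun q => ∑ a, ∑ b, bracket I η g (φ a) q
      * (bracketMatrix I η φ q)⁻¹ a b * bracket I η (φ b) h q) :=
    contMDiffOn_finsetSum fun a _ => contMDiffOn_finsetSum fun b _ =>
      ContMDiffOn.mul (ContMDiffOn.mul (hg.bracket hη hU (hφ a))
        (SmoothOn.bracketMatrix_inv hη hU hφ hC a b)) ((hφ b).bracket hη hU hh)
  have hd : mvfderiv I (djBracket I η φ g h) p = mvfderiv I (bracket I η g h) p := by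
    have h1 : mvfderiv I (djBracket I η φ g h) p = mvfderiv I (bracket I η g h) p -
        mvfderiv I (fun q => ∑ a, ∑ b, bracket I η g (φ a) q
          * (bracketMatrix I η φ q)⁻¹ a b * bracket I η (φ b) h q) p :=
      mvfderiv_fun_sub (d (hg.bracket hη hU hh)) (d hS)
    rw [h1, mvfderiv_pairing_eq_zero (A := fun q => (bracketMatrix I η φ q)⁻¹)
      (fun a b => d (SmoothOn.bracketMatrix_inv hη hU hφ hC a b))
      (fun a => d (hg.bracket hη hU (hφ a))) (fun b => d ((hφ b).bracket hη hU hh)) hg0 hh0',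
      sub_zero]
  rw [djBracket_eq, z hf0, map_zero, LinearMap.zero_apply, sub_zero]
  simp only [bracket, reebDeriv, hd, hv]

lemma djBracket_jacobi (hη : IsContactForm I η) (hU : IsOpen U)
    (hφ : ∀ a, SmoothOn I U (φ a)) (hC : ∀ p ∈ U, IsUnit (bracketMatrix I η φ p).det)
    (hf : SmoothOn I U f) (hg : SmoothOn I U g) (hh : SmoothOn I U h) (hp : p ∈ U) :
    djBracket I η φ f (djBracket I η φ g h) p + djBracket I η φ g (djBracket I η φ h f) p
      + djBracket I η φ h (djBracket I η φ f g) p = 0 := by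
  obtain ⟨f', hf', hf0, hff⟩ := exists_adapted hη hU hφ hC hf hp
  obtain ⟨g', hg', hg0, hgg⟩ := exists_adapted hη hU hφ hC hg hp
  obtain ⟨h', hh', hh0, hhh⟩ := exists_adapted hη hU hφ hC hh hp
  -- Adapted functions have the same Dirac-Jacobi brackets on all of `U`, hence by skew-symmetry
  -- both arguments of an inner bracket may be replaced as well.
  have key {a b a' b' : M → ℝ} (ha : ∀ k, ∀ q ∈ U, djBracket I η φ a' k q = djBracket I η φ a k q)
      (hb : ∀ k, ∀ q ∈ U, djBracket I η φ b' k q = djBracket I η φ b k q) (q : M) (hq : q ∈ U) :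
      djBracket I η φ a b q = djBracket I η φ a' b' q := by
    rw [ha _ q hq, hη.djBracket_swap (hC q hq), ← hb _ q hq, ← hη.djBracket_swap (hC q hq)]
  rw [← hff _ p hp, ← hgg _ p hp, ← hhh _ p hp, djBracket_congr_right hU hp (key hgg hhh),
    djBracket_congr_right hU hp (key hhh hff), djBracket_congr_right hU hp (key hff hgg),
    djBracket_djBracket_of_adapted hη hU hφ hC hg' hh' hp hf0 hg0 hh0,
    djBracket_djBracket_of_adapted hη hU hφ hC hh' hf' hp hg0 hh0 hf0,
    djBracket_djBracket_of_adapted hη hU hφ hC hf' hg' hp hh0 hf0 hg0]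
  exact hη.jacobi_cyclic hU hf' hg' hh' hp

/-- The Dirac-Jacobi bracket is a Jacobi bracket. -/
theorem isJacobiBracketOn_djBracket (hη : IsContactForm I η) (hU : IsOpen U)
    (hφ : ∀ a, SmoothOn I U (φ a)) (hC : ∀ p ∈ U, IsUnit (bracketMatrix I η φ p).det) :
    IsJacobiBracketOn I U (djBracket I η φ) (fun p => -djReeb I η φ p) := by
  have hbr (f g : M → ℝ) (p : M) (hp : p ∈ U) : djBracket I η φ f g p =
      hη.djBivector φ p (mvfderiv I f p) (mvfderiv I g p)
        + f p * mvfderiv I g p (-djReeb I η φ p) - g p * mvfderiv I f p (-djReeb I η φ p) := by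
    rw [hη.djBracket_eq_djBivector (hC p hp), map_neg, map_neg, djReebDeriv, djReebDeriv]
    ring
  have hsm (f g : M → ℝ) (hf : SmoothOn I U f) (hg : SmoothOn I U g) :=
    SmoothOn.djBracket hη hU hφ hC hf hg
  have hR : SmoothFieldOn I U (fun p => -djReeb I η φ p) := fun p hp => by
    refine smoothFieldWithinAt_iff.2 ?_
    simp only [map_neg]
    exact (smoothFieldWithinAt_iff.1 (smoothFieldOn_djReeb hη hU hφ hC p hp)).neg
  have hV (f : M → ℝ) (hf : SmoothOn I U f) := hR.apply hU subset_rfl hf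
  have hΛ (f g : M → ℝ) (hf : SmoothOn I U f) (hg : SmoothOn I U g) :
      SmoothOn I U (fun p => hη.djBivector φ p (mvfderiv I f p) (mvfderiv I g p)) := by
    -- The bivector evaluated on `df, dg` is recovered from the smooth bracket by subtracting its
    -- first order terms.
    refine ((ContMDiffOn.sub (hsm f g hf hg) (ContMDiffOn.mul hf (hV g hg))).add
      (ContMDiffOn.mul hg (hV f hf))).congr fun p hp => ?_
    change _ = djBracket I η φ f g p - f p * mvfderiv I g p (-djReeb I η φ p)
      + g p * mvfderiv I f p (-djReeb I η φ p)
    rw [hbr f g p hp]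
    ring
  have hsk (p : M) (hp : p ∈ U) := hη.djBivector_swap (φ := φ) (hC p hp)
  have hj (f g h : M → ℝ) (hf : SmoothOn I U f) (hg : SmoothOn I U g) (hh : SmoothOn I U h)
      (p : M) (hp : p ∈ U) := djBracket_jacobi hη hU hφ hC hf hg hh hp
  obtain ⟨hlie, hsch⟩ := jacobiStructure_of_jacobi (Λ := hη.djBivector φ) hU
    (fun f g _ _ p hp => hbr f g p hp) hΛ hV hsm hsk hj
  refine ⟨⟨hη.djBivector φ, ⟨hsk, hΛ, hR, fun f g h hf hg hh p hp => ?_, hlie⟩,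
    fun f g _ _ => hbr f g⟩, hsm, ?_, ?_, ?_, hj, ?_⟩
  · rw [hsch f g h hf hg hh p hp]
  · intro f g h hf hg _ p hp
    simp only [hbr _ _ p hp, mvfderiv_add (hf.mdifferentiableAt hU hp)
      (hg.mdifferentiableAt hU hp), map_add, LinearMap.add_apply, add_apply, Pi.add_apply]
    ring
  · intro c f g hf _ p hp
    have hd : mvfderiv I (c • f) p = c • mvfderiv I f p := by
      have h1 := mvfderiv_smul (I := I) (a := fun _ : M => c) mdifferentiableAt_const
        (hf.mdifferentiableAt hU hp)
      rw [mvfderiv_const] at h1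
      refine h1.trans ?_
      ext v
      simp
    simp only [hbr _ _ p hp, hd, map_smul, LinearMap.smul_apply, smul_apply, Pi.smul_apply,
      smul_eq_mul]
    ring
  · exact fun f g _ _ p hp => hη.djBracket_swap (hC p hp) f g
  · intro f g _ _ p _ hf0
    have hd : mvfderiv I f p = 0 := by
      ext v
      have h1 := DFunLike.congr_fun (hf0.mfderiv_eq (I := I) (I' := 𝓘(ℝ, ℝ))) v
      refine Eq.trans h1 ?_
      exact DFunLike.congr_fun (mvfderiv_const (I := I) (x := p) (0 : ℝ)) v
    rw [hbr _ _ p ‹_›, hd, hf0.self_of_nhds]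
    simp

end DiracBracket

/-! ### Tangent spaces of sets cut out by independent functions -/

section Tangent

variable {E : Type*} [NormedAddCommGroup E] [NormedSpace ℝ E]
  {W : Type*} [TopologicalSpace W] {I : ModelWithCorners ℝ E W}
  {M : Type*} [TopologicalSpace M] [ChartedSpace W M]
  {η : (p : M) → TangentSpace I p →L[ℝ] ℝ} {p : M} {S S' U : Set M} {f : M → ℝ}

variable (I) in
/-- On the open set `U`, the set `S` is the common zero set of the functions `ψ s`, which are
independent at its points. -/
structure IsCutOut {σ : Type*} (ψ : σ → M → ℝ) (S U : Set M) : Prop where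
  isOpen : IsOpen U
  smooth : ∀ s, SmoothOn I U (ψ s)
  mem_iff : ∀ q ∈ U, q ∈ S ↔ ∀ s, ψ s q = 0
  independent : ∀ q ∈ S ∩ U, LinearIndependent ℝ (fun s => mvfderiv I (ψ s) q)

lemma mem_tangentTo {v : TangentSpace I p} :
    v ∈ tangentTo I S p ↔ ∀ f : M → ℝ, ContMDiffAt I 𝓘(ℝ, ℝ) ∞ f p →
      (∀ᶠ q in 𝓝[S] p, f q = 0) → mvfderiv I f p v = 0 := by
  simp only [tangentTo, Submodule.mem_iInf, Set.mem_ofPred_eq, and_imp]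
  rfl

lemma tangentTo_mono (h : S ⊆ S') : tangentTo I S p ≤ tangentTo I S' p := fun _ hv =>
  mem_tangentTo.2 fun f hf hf0 => mem_tangentTo.1 hv f hf (hf0.filter_mono (nhdsWithin_mono p h))

lemma mvfderiv_eq_of_eqOn {g : M → ℝ} (hf : ContMDiffAt I 𝓘(ℝ, ℝ) ∞ f p)
    (hg : ContMDiffAt I 𝓘(ℝ, ℝ) ∞ g p) (hfg : ∀ᶠ q in 𝓝[S] p, f q = g q)
    {v : TangentSpace I p} (hv : v ∈ tangentTo I S p) :
    mvfderiv I f p v = mvfderiv I g p v := by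
  have h := mem_tangentTo.1 hv (fun q => f q - g q) (hf.sub hg)
    (hfg.mono fun q hq => sub_eq_zero.2 hq)
  rwa [mvfderiv_fun_sub (hf.mdifferentiableAt (by simp)) (hg.mdifferentiableAt (by simp)),
    sub_apply, sub_eq_zero] at h

lemma constraintSet_subset (η : (p : M) → TangentSpace I p →L[ℝ] ℝ) (S : Set M) (h : M → ℝ)
    (i : ℕ) : constraintSet I η S h i ⊆ S := by
  induction i with
  | zero => exact subset_rfl
  | succ i ih => exact fun q hq => ih hq.1

lemma linearIndependent_comp_ofModel [IsManifold I ∞ M] {σ : Type*} [Fintype σ]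
    {α : σ → TangentSpace I p →L[ℝ] ℝ} (hα : LinearIndependent ℝ α) :
    LinearIndependent ℝ (fun s => (α s).comp (ofModel I p p)) := by
  rw [Fintype.linearIndependent_iff] at hα ⊢
  refine fun g hg => hα g ?_
  ext v
  have h := DFunLike.congr_fun hg (toModel I p p v)
  simpa [ofModel_toModel (mem_extChartAt_source (I := I) p)] using h

variable {σ : Type*} [Fintype σ] {ψ : σ → M → ℝ}
variable [FiniteDimensional ℝ E] [IsManifold I ∞ M] [I.Boundaryless]

omit [FiniteDimensional ℝ E] [IsManifold I ∞ M] in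
lemma contDiffAt_comp_symm (hf : ContMDiffAt I 𝓘(ℝ, ℝ) ∞ f p) :
    ContDiffAt ℝ ∞ (f ∘ (extChartAt I p).symm) (extChartAt I p p) := by
  have h := (contMDiffAt_iff.1 hf).2
  rw [I.range_eq_univ, contDiffWithinAt_univ] at h
  exact h

/-- Lagrange multipliers. -/
lemma IsCutOut.exists_multipliers (h : IsCutOut I ψ S U) (hp : p ∈ S ∩ U)
    (hf : ContMDiffAt I 𝓘(ℝ, ℝ) ∞ f p) (hf0 : ∀ᶠ q in 𝓝[S] p, f q = 0) :
    ∃ c : σ → ℝ, mvfderiv I f p = ∑ s, c s • mvfderiv I (ψ s) p := by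
  have := FiniteDimensional.complete ℝ E
  have hx := mem_extChartAt_source (I := I) p
  have hψ (s : σ) := (h.smooth s).contMDiffAt h.isOpen hp.2
  have hp0 : ∀ s, ψ s p = 0 := (h.mem_iff p hp.2).1 hp.1
  have hfp : f p = 0 := hf0.self_of_nhdsWithin hp.1
  have hs := (extChartAt I p).left_inv hx
  have hev : ∀ᶠ y in 𝓝 (extChartAt I p p), (extChartAt I p).symm y ∈ U ∧
      ((extChartAt I p).symm y ∈ S → f ((extChartAt I p).symm y) = 0) := by
    have ht := continuousAt_extChartAt_symm (I := I) p
    rw [ContinuousAt, hs] at ht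
    exact ht.eventually
      (Filter.Eventually.and (h.isOpen.mem_nhds hp.2) (eventually_nhdsWithin_iff.1 hf0))
  -- A function vanishing on `S` is constant there near `p`, so `p` is trivially a constrained
  -- extremum and Lagrange multipliers apply.
  have hext : IsLocalExtrOn (f ∘ (extChartAt I p).symm)
      {y | ∀ s, (ψ s ∘ (extChartAt I p).symm) y =
        (ψ s ∘ (extChartAt I p).symm) (extChartAt I p p)} (extChartAt I p p) := by
    refine Or.inl (eventually_nhdsWithin_iff.2 (hev.mono fun y hy hyS => ?_))
    simp only [Function.comp_apply, hs, hp0, Set.mem_ofPred_eq, hfp] at hyS ⊢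
    exact (hy.2 ((h.mem_iff _ hy.1).2 hyS)).ge
  obtain ⟨Λ, Λ₀, hne, hsum⟩ := hext.exists_multipliers_of_hasStrictFDerivAt
    (fun s => (contDiffAt_comp_symm (hψ s)).hasStrictFDerivAt (by simp))
    ((contDiffAt_comp_symm hf).hasStrictFDerivAt (by simp))
  have hsum' : (∑ s, Λ s • mvfderiv I (ψ s) p) + Λ₀ • mvfderiv I f p = 0 := by
    ext v
    have h1 := DFunLike.congr_fun hsum (toModel I p p v)
    simpa [-extChartAt, IsContactForm.fderiv_comp_symm hx ((hψ _).mdifferentiableAt (by simp)),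
      IsContactForm.fderiv_comp_symm hx (hf.mdifferentiableAt (by simp)), ofModel_toModel hx] using h1
  -- If the multiplier of `f` were zero, the others would form a nontrivial relation between the
  -- independent differentials.
  have h0 : Λ₀ ≠ 0 := by
    rintro rfl
    rw [zero_smul, add_zero] at hsum'
    exact hne (Prod.ext (funext (Fintype.linearIndependent_iff.1 (h.independent p hp) Λ hsum')) rfl)
  refine ⟨fun s => -Λ₀⁻¹ * Λ s, ?_⟩
  simp only [mul_smul, ← Finset.smul_sum]
  rw [eq_neg_of_add_eq_zero_left hsum', smul_neg, neg_smul, neg_neg, smul_smul,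
    inv_mul_cancel₀ h0, one_smul]

lemma IsCutOut.mem_tangentTo_iff (h : IsCutOut I ψ S U) (hp : p ∈ S ∩ U) {v : TangentSpace I p} :
    v ∈ tangentTo I S p ↔ ∀ s, mvfderiv I (ψ s) p v = 0 := by
  refine ⟨fun hv s => mem_tangentTo.1 hv _ ((h.smooth s).contMDiffAt h.isOpen hp.2) ?_,
    fun hv => mem_tangentTo.2 fun f hf hf0 => ?_⟩
  · filter_upwards [self_mem_nhdsWithin, nhdsWithin_le_nhds (h.isOpen.mem_nhds hp.2)] with q hq hqU
    exact (h.mem_iff q hqU).1 hq s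
  · obtain ⟨c, hc⟩ := h.exists_multipliers hp hf hf0
    simp [hc, hv]

/-- The annihilator of the tangent space is spanned by the differentials of the constraints. -/
lemma IsCutOut.exists_eq_sum (h : IsCutOut I ψ S U) (hp : p ∈ S ∩ U) (α : TangentSpace I p →ₗ[ℝ] ℝ)
    (hα : ∀ v ∈ tangentTo I S p, α v = 0) :
    ∃ c : σ → ℝ, ∀ v, α v = ∑ s, c s * mvfderiv I (ψ s) p v := by
  have h1 : α ∈ Submodule.span ℝ
      (Set.range fun s => (mvfderiv I (ψ s) p : TangentSpace I p →ₗ[ℝ] ℝ)) := by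
    refine mem_span_of_iInf_ker_le_ker fun v hv => hα v ((h.mem_tangentTo_iff hp).2 fun s => ?_)
    exact (Submodule.mem_iInf _).1 hv s
  obtain ⟨c, rfl⟩ := (Submodule.mem_span_range_iff_exists_fun ℝ).1 h1
  exact ⟨c, fun v => by simp⟩

end Tangent

/-! ### Smooth dependence of coefficients -/

section Coefficients

/-- The map `x ↦ (a_s(x))_s` is onto: a nonzero functional vanishing on its range would be a linear
relation between the `a_s`. -/
lemma exists_dual_family {E : Type*} [NormedAddCommGroup E] [NormedSpace ℝ E] {σ : Type*}
    [Fintype σ] [DecidableEq σ] {a : σ → E →L[ℝ] ℝ} (ha : LinearIndependent ℝ a) :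
    ∃ v : σ → E, ∀ s t, a s (v t) = if s = t then 1 else 0 := by
  have hr : LinearMap.range (LinearMap.pi fun s => (a s : E →ₗ[ℝ] ℝ)) = ⊤ := by
    by_contra hne
    obtain ⟨l, hl0, hl⟩ := Submodule.exists_le_ker_of_lt_top _ (lt_top_iff_ne_top.2 hne)
    refine hl0 (LinearMap.pi_ext' fun s => LinearMap.ext_ring ?_)
    refine Fintype.linearIndependent_iff.1 ha (fun s => l (Pi.single s 1)) ?_ s
    ext x
    have h1 : l (fun s => a s x) = 0 := hl ⟨x, rfl⟩
    rw [LinearMap.pi_apply_eq_sum_univ] at h1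
    have h2 (s : σ) : (fun j => if s = j then (1 : ℝ) else 0) = Pi.single s 1 := by
      funext j
      simp [Pi.single_apply, eq_comm]
    simpa [h2, mul_comm] using h1
  choose v hv using fun t => LinearMap.range_eq_top.1 hr (Pi.single t 1)
  refine ⟨v, fun s t => (congrFun (hv t) s).trans ?_⟩
  rw [Pi.single_apply]

variable {E : Type*} [NormedAddCommGroup E] [NormedSpace ℝ E]
  {W : Type*} [TopologicalSpace W] {I : ModelWithCorners ℝ E W}
  {M : Type*} [TopologicalSpace M] [ChartedSpace W M]

/-- The coefficients of a smooth covector field with respect to independent smooth covector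
fields are smooth. -/
lemma contMDiffWithinAt_coefficients {V : Type*} [NormedAddCommGroup V] [NormedSpace ℝ V]
    {σ : Type*} [Fintype σ] {a : σ → M → V →L[ℝ] ℝ}
    {β : M → V → ℝ} {c : σ → M → ℝ} {S : Set M} {p : M} (hp : p ∈ S)
    (ha : ∀ s v, ContMDiffWithinAt I 𝓘(ℝ, ℝ) ∞ (fun q => a s q v) S p)
    (hβ : ∀ v, ContMDiffWithinAt I 𝓘(ℝ, ℝ) ∞ (fun q => β q v) S p)
    (hli : LinearIndependent ℝ (fun s => a s p))
    (h : ∀ᶠ q in 𝓝[S] p, ∀ v, β q v = ∑ s, c s q * a s q v) (s : σ) :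
    ContMDiffWithinAt I 𝓘(ℝ, ℝ) ∞ (c s) S p := by
  classical
  obtain ⟨v, hv⟩ := exists_dual_family hli
  -- The dual family is fixed at `p`. The matrix of values on it is the identity at `p`, hence
  -- invertible nearby, and its inverse expresses the coefficients through the values of `β`.
  let A : M → Matrix σ σ ℝ := fun q => Matrix.of fun s t => a s q (v t)
  have hA1 : A p = 1 := by
    ext s t
    simp [A, hv, Matrix.one_apply]
  have hdet : (A p).det ≠ 0 := by simp [hA1]
  have hA : ContMDiffWithinAt I 𝓘(ℝ, σ → σ → ℝ) ∞ (fun q s t => A q s t) S p :=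
    contMDiffWithinAt_pi_space.2 fun s => contMDiffWithinAt_pi_space.2 fun t => ha s (v t)
  have hcont : ContinuousWithinAt (fun q => (A q).det) S p :=
    ContinuousAt.comp_continuousWithinAt (f := fun q s t => A q s t)
      (contDiff_det.continuous.continuousAt (x := fun s t => A p s t)) hA.continuousWithinAt
  have hev : ∀ᶠ q in 𝓝[S] p, c s q = ∑ t, β q (v t) * (A q)⁻¹ t s := by
    filter_upwards [h, hcont.eventually_ne hdet] with q hq hqd
    have h1 : Matrix.vecMul (fun s => c s q) (A q) = fun t => β q (v t) :=
      funext fun t => (hq (v t)).symm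
    have h2 : Matrix.vecMul (fun t => β q (v t)) (A q)⁻¹ = fun s => c s q := by
      rw [← h1, Matrix.vecMul_vecMul, Matrix.mul_nonsing_inv _ hqd.isUnit, Matrix.vecMul_one]
    exact (congrFun h2 s).symm
  refine ContMDiffWithinAt.congr_of_eventuallyEq (contMDiffWithinAt_finsetSum fun t _ => ?_) hev
    (hev.self_of_nhdsWithin hp)
  exact (hβ (v t)).mul (contMDiffWithinAt_matrix_inv (fun s t => ha s (v t)) hdet t s)

end Coefficients

/-! ### Motions on the final constraint submanifold -/

section Dynamics

variable {E : Type*} [NormedAddCommGroup E] [NormedSpace ℝ E] [FiniteDimensional ℝ E]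
  {W : Type*} [TopologicalSpace W] {I : ModelWithCorners ℝ E W}
  {M : Type*} [TopologicalSpace M] [ChartedSpace W M]
  [IsManifold I ∞ M] [I.Boundaryless]
  {η : (p : M) → TangentSpace I p →L[ℝ] ℝ} {p : M} {M₁ N S U : Set M} {f h h₁ : M → ℝ}

/-! ### Smoothness of covector fields in a chart -/

omit [FiniteDimensional ℝ E] in
lemma SmoothOn.contMDiffAt_mvfderiv_ofModel (hf : SmoothOn I U f) (hU : IsOpen U) (hp : p ∈ U)
    (v : E) : ContMDiffAt I 𝓘(ℝ, ℝ) ∞ (fun q => mvfderiv I f q (ofModel I p q v)) p :=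
  contMDiffAt_of_chart hU hp
    (((hf.contDiffOn_chart p).fderiv_of_isOpen
      ((continuousOn_extChartAt_symm p).isOpen_inter_preimage (isOpen_extChartAt_target p) hU)
      (by simp)).clm_apply contDiffOn_const)
    fun x hx hxU => by
      rw [IsContactForm.fderiv_comp_symm hx (hf.mdifferentiableAt hU hxU)]
      rfl

omit [FiniteDimensional ℝ E] in
lemma IsSmoothForm.contMDiffAt_formInChart (hη : IsSmoothForm I η) (p : M) :
    ContMDiffAt I 𝓘(ℝ, E →L[ℝ] ℝ) ∞ (fun q => formInChart I η p (extChartAt I p q)) p :=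
  contMDiffAt_of_chart isOpen_univ (Set.mem_univ p)
    ((contDiffOn_formInChart hη p).mono Set.inter_subset_left) fun _ _ _ => rfl

omit [FiniteDimensional ℝ E] in
lemma IsSmoothForm.contMDiffAt_ofModel (hη : IsSmoothForm I η) (p : M) (v : E) :
    ContMDiffAt I 𝓘(ℝ, ℝ) ∞ (fun q => η q (ofModel I p q v)) p := by
  refine ContMDiffAt.congr_of_eventuallyEq
    ((hη.contMDiffAt_formInChart p).clm_apply (contMDiffAt_const (c := v)))
    ((eventually_mem_source (I := I) isOpen_univ (Set.mem_univ p)).mono fun q hq => ?_)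
  change η q (ofModel I p q v) = formInChart I η p (extChartAt I p q) v
  rw [← formInChart_toModel η hq.1, toModel_ofModel hq.1]

omit [FiniteDimensional ℝ E] in
lemma IsSmoothForm.contMDiffWithinAt_apply (hη : IsSmoothForm I η)
    {X : (p : M) → TangentSpace I p}
    (hX : ContMDiffWithinAt I 𝓘(ℝ, E) ∞ (fun q => toModel I p q (X q)) S p) :
    ContMDiffWithinAt I 𝓘(ℝ, ℝ) ∞ (fun q => η q (X q)) S p := by
  have he := eventually_mem_source (I := I) isOpen_univ (Set.mem_univ p)
  have he' (q : M) (hq : q ∈ (extChartAt I p).source ∧ q ∈ Set.univ) :=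
    (formInChart_toModel η hq.1 (X q)).symm
  exact ((hη.contMDiffAt_formInChart p).contMDiffWithinAt.clm_apply hX).congr_of_eventuallyEq
    (nhdsWithin_le_nhds (he.mono he')) (he' p he.self_of_nhds)

omit [FiniteDimensional ℝ E] in
lemma IsSmoothForm.contMDiffWithinAt_dForm (hη : IsSmoothForm I η)
    {X : (p : M) → TangentSpace I p}
    (hX : ContMDiffWithinAt I 𝓘(ℝ, E) ∞ (fun q => toModel I p q (X q)) S p) (v : E) :
    ContMDiffWithinAt I 𝓘(ℝ, ℝ) ∞ (fun q => dForm I η q (X q) (ofModel I p q v)) S p := by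
  have h1 : ContMDiffAt I 𝓘(ℝ, E →L[ℝ] E →L[ℝ] ℝ) ∞
      (fun q => fderiv ℝ (formInChart I η p) (extChartAt I p q)) p :=
    contMDiffAt_of_chart isOpen_univ (Set.mem_univ p)
      (((contDiffOn_formInChart hη p).fderiv_of_isOpen (isOpen_extChartAt_target p)
        (by simp)).mono Set.inter_subset_left) fun _ _ _ => rfl
  have he := eventually_mem_source (I := I) isOpen_univ (Set.mem_univ p)
  have he' (q : M) (hq : q ∈ (extChartAt I p).source ∧ q ∈ Set.univ) :
      dForm I η q (X q) (ofModel I p q v) =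
        fderiv ℝ (formInChart I η p) (extChartAt I p q) (toModel I p q (X q)) v
        - fderiv ℝ (formInChart I η p) (extChartAt I p q) v (toModel I p q (X q)) := by
    rw [dForm_eq_curl hη hq.1, toModel_ofModel hq.1, curl_apply]
  exact (((h1.contMDiffWithinAt.clm_apply hX).clm_apply contMDiffWithinAt_const).sub
    ((h1.contMDiffWithinAt.clm_apply contMDiffWithinAt_const).clm_apply hX)).congr_of_eventuallyEq
    (nhdsWithin_le_nhds (he.mono he')) (he' p he.self_of_nhds)

/-! ### The multipliers -/

/-- The defect `♭(v) - (dh - (R(h) + h) η)` of Hamilton's equation on the contact manifold. -/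
def hamiltonDefect (η : (p : M) → TangentSpace I p →L[ℝ] ℝ) (h : M → ℝ) (p : M)
    (v : TangentSpace I p) : TangentSpace I p →ₗ[ℝ] ℝ :=
  dFormLin η p v + η p v • (η p : TangentSpace I p →ₗ[ℝ] ℝ)
    - (mvfderiv I h p : TangentSpace I p →ₗ[ℝ] ℝ)
    + (reebDeriv I η h p + h p) • (η p : TangentSpace I p →ₗ[ℝ] ℝ)

omit [FiniteDimensional ℝ E] in
lemma hamiltonDefect_apply (hη : IsSmoothForm I η) (h : M → ℝ) (v w : TangentSpace I p) :
    hamiltonDefect η h p v w = dForm I η p v w + η p v * η p w - mvfderiv I h p w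
      + (reebDeriv I η h p + h p) * η p w := by
  rw [dForm_eq_dFormLin hη]
  rfl

-- Hamilton's equation is tested on the Reeb vector `R₁` itself: the `dη` term vanishes and the
-- derivative of `h₁` along `R₁` cancels.
omit [FiniteDimensional ℝ E] in
lemma SolvesHamilton.eta_eq (hη : IsSmoothForm I η) {v : TangentSpace I p}
    (hv : SolvesHamilton I η M₁ h₁ p v) : η p v = -h₁ p := by
  obtain ⟨hv, R₁, hR, h1, h2, h3⟩ := hv
  have h4 := h3 R₁ hR
  rw [dForm_swap hη, h2 v hv, h1] at h4
  linarith

omit [FiniteDimensional ℝ E] in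
/-- On the primary constraint submanifold the defect is a multiple of `η`. -/
lemma SolvesHamilton.exists_defect (hη : IsSmoothForm I η) {v : TangentSpace I p}
    (hv : SolvesHamilton I η M₁ h₁ p v) (hp : p ∈ M₁) (hh : ContMDiffAt I 𝓘(ℝ, ℝ) ∞ h p)
    (hh₁ : ContMDiffAt I 𝓘(ℝ, ℝ) ∞ h₁ p) (heq : ∀ᶠ q in 𝓝[M₁] p, h q = h₁ q) :
    ∃ c : ℝ, ∀ w ∈ tangentTo I M₁ p, hamiltonDefect η h p v w = c * η p w := by
  obtain ⟨_, R₁, hR, _, _, h3⟩ := hv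
  -- On `T M₁` the differentials of `h` and `h₁` agree, so the two equations differ only in the Reeb
  -- derivative multiplying `η`.
  refine ⟨reebDeriv I η h p - mvfderiv I h₁ p R₁, fun w hw => ?_⟩
  rw [hamiltonDefect_apply hη, h3 w hw, mvfderiv_eq_of_eqOn hh hh₁ heq hw,
    heq.self_of_nhdsWithin hp]
  ring

variable {σ : Type*} [Fintype σ] {ψ : σ → M → ℝ}

lemma IsContactForm.hamField_add_sum (hη : IsContactForm I η) (h : M → ℝ) (ψ : σ → M → ℝ)
    (u : σ → ℝ) (p : M) :
    hamField I η h p + ∑ s, u s • hamField I η (ψ s) p = sharp I η p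
      ((mvfderiv I h p - (reebDeriv I η h p + h p) • η p) + ∑ s, u s •
        (mvfderiv I (ψ s) p - (reebDeriv I η (ψ s) p + ψ s p) • η p)) := by
  rw [hη.sharp_add, ← hη.sharpLin_apply (∑ s, _), map_sum]
  simp only [map_smul]
  rfl

/-- If the defect is a combination of `η` and the differentials of functions vanishing at `p`,
the solution is a combination of Hamiltonian vector fields. -/
lemma IsContactForm.eq_hamField_add_sum (hη : IsContactForm I η) {v : TangentSpace I p} {c : ℝ}
    {u : σ → ℝ} (hv : η p v = -h p) (hψ : ∀ s, ψ s p = 0)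
    (hu : ∀ w, hamiltonDefect η h p v w = c * η p w + ∑ s, u s * mvfderiv I (ψ s) p w) :
    v = hamField I η h p + ∑ s, u s • hamField I η (ψ s) p := by
  obtain ⟨hR1, hR2⟩ := hη.reeb_spec p
  -- The defect vanishes on the Reeb vector because `η(v) = -h(p)`; evaluating there determines `c`.
  -- As `ψ_s(p) = 0`, this is the coefficient of `η` needed for `♭(X_{ψ_s})`.
  have hc : c = -∑ s, u s * reebDeriv I η (ψ s) p := by
    have h1 := hu (reeb I η p)
    rw [hamiltonDefect_apply hη.1, dForm_swap hη.1, hR2, hR1, hv] at h1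
    simp only [reebDeriv] at h1 ⊢
    linarith
  rw [hη.hamField_add_sum]
  refine hη.eq_sharp fun w => ?_
  have h1 := hu w
  rw [hamiltonDefect_apply hη.1, hc] at h1
  have h2 : ∑ s, u s * (mvfderiv I (ψ s) p w - reebDeriv I η (ψ s) p * η p w) =
      (∑ s, u s * mvfderiv I (ψ s) p w) - (∑ s, u s * reebDeriv I η (ψ s) p) * η p w := by
    rw [Finset.sum_mul, ← Finset.sum_sub_distrib]
    exact Finset.sum_congr rfl fun s _ => by ring
  simp [hψ, h2]
  linarith

/-- Every motion on the final constraint submanifold is the sum of the Hamiltonian vector field of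
an extension of the Hamiltonian and multiples of those of the constraints. -/
theorem exists_multipliers (hη : IsContactForm I η) (hM₁ : IsSubmanifold I M₁)
    (hh₁ : ∀ p ∈ M₁, ContMDiffAt I 𝓘(ℝ, ℝ) ∞ h₁ p) (hNM : N ⊆ M₁) (hN : IsCutOut I ψ N U)
    (hh : SmoothOn I U h) (hhh : ∀ p ∈ M₁ ∩ U, h p = h₁ p) (X : (p : M) → TangentSpace I p)
    (hX : ∀ p ∈ N ∩ U, X p ∈ tangentTo I N p ∧ SolvesHamilton I η M₁ h₁ p (X p)) :
    ∃ u : σ → M → ℝ,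
      (∀ p ∈ N ∩ U, X p = hamField I η h p + ∑ s, u s p • hamField I η (ψ s) p) ∧
      (SmoothFieldOn I (N ∩ U) X → ∀ s, SmoothOn I (N ∩ U) (u s)) := by
  have key (q : M) (hq : q ∈ N ∩ U) : ∃ (c : ℝ) (u : σ → ℝ),
      (∀ w ∈ tangentTo I M₁ q, hamiltonDefect η h q (X q) w = c * η q w) ∧
      ∀ w, hamiltonDefect η h q (X q) w = c * η q w + ∑ s, u s * mvfderiv I (ψ s) q w := by
    have heq : ∀ᶠ q in 𝓝[M₁] q, h q = h₁ q := by
      filter_upwards [self_mem_nhdsWithin, nhdsWithin_le_nhds (hN.isOpen.mem_nhds hq.2)]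
        with x hx hxU
      exact hhh x ⟨hx, hxU⟩
    obtain ⟨c, hc⟩ := (hX q hq).2.exists_defect hη.1 (hNM hq.1) (hh.contMDiffAt hN.isOpen hq.2)
      (hh₁ q (hNM hq.1)) heq
    -- The defect minus `c η` annihilates `T M₁`, a fortiori `T N`.
    obtain ⟨u, hu⟩ := hN.exists_eq_sum hq
      (hamiltonDefect η h q (X q) - c • (η q : TangentSpace I q →ₗ[ℝ] ℝ))
      (fun w hw => by simp [hc w (tangentTo_mono hNM hw)])
    exact ⟨c, u, hc, fun w => by simpa [sub_eq_iff_eq_add'] using hu w⟩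
  choose! c u hc hu using key
  refine ⟨fun s q => u q s, fun q hq => ?_, fun hXs s p hp => ?_⟩
  · exact hη.eq_hamField_add_sum (((hX q hq).2.eta_eq hη.1).trans
      (congrArg _ (hhh q ⟨hNM hq.1, hq.2⟩).symm)) ((hN.mem_iff q hq.2).1 hq.1) (hu q hq)
  have hXp := smoothFieldWithinAt_iff.1 (hXs p hp)
  have hβ (v : E) : ContMDiffWithinAt I 𝓘(ℝ, ℝ) ∞
      (fun q => hamiltonDefect η h q (X q) (ofModel I p q v)) (N ∩ U) p := by
    simp only [hamiltonDefect_apply hη.1]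
    have h1 := (hη.1.contMDiffAt_ofModel p v).contMDiffWithinAt (s := N ∩ U)
    exact ((((hη.1.contMDiffWithinAt_dForm hXp v).add
      ((hη.1.contMDiffWithinAt_apply hXp).mul h1)).sub
      (hh.contMDiffAt_mvfderiv_ofModel hN.isOpen hp.2 v).contMDiffWithinAt)).add
      (((((hh.reebDeriv hη hN.isOpen).contMDiffAt hN.isOpen hp.2).add
        (hh.contMDiffAt hN.isOpen hp.2)).contMDiffWithinAt).mul h1)
  -- The smoothness of `c` has to be found on `M₁`: `η` may vanish on `T N`, and then the
  -- constraints `ψ` alone do not determine `c`. On `T M₁` it does not vanish, so `c` is the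
  -- coefficient of `η` in an independent family.
  have hcs : ContMDiffWithinAt I 𝓘(ℝ, ℝ) ∞ c (N ∩ U) p := by
    obtain ⟨k, hk⟩ := hM₁
    obtain ⟨V, θ, hV, hpV, hθ, hmem, hli⟩ := hk p (hNM hp.1)
    have hcut : IsCutOut I θ M₁ V := ⟨hV, hθ, hmem, hli⟩
    have key' (q : M) (hq : q ∈ N ∩ U ∩ V) : ∃ d : Fin k → ℝ, ∀ w,
        hamiltonDefect η h q (X q) w = c q * η q w + ∑ i, d i * mvfderiv I (θ i) q w := by
      obtain ⟨d, hd⟩ := hcut.exists_eq_sum ⟨hNM hq.1.1, hq.2⟩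
        (hamiltonDefect η h q (X q) - c q • (η q : TangentSpace I q →ₗ[ℝ] ℝ))
        (fun w hw => by simp [hc q hq.1 w hw])
      exact ⟨d, fun w => by simpa [sub_eq_iff_eq_add'] using hd w⟩
    choose! d hd using key'
    -- A combination of the `dθ_i` vanishes on `T M₁`, whereas `η(R₁) = 1` for the Reeb vector `R₁`
    -- in `T M₁`.
    have hnot : η p ∉ Submodule.span ℝ (Set.range fun i => mvfderiv I (θ i) p) := fun hmem' => by
      obtain ⟨e, he⟩ := (Submodule.mem_span_range_iff_exists_fun ℝ).1 hmem'
      obtain ⟨_, R₁, hR, h1, _⟩ := (hX p hp).2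
      have h2 := (hcut.mem_tangentTo_iff ⟨hNM hp.1, hpV⟩).1 hR
      rw [← he] at h1
      simp [h2] at h1
    have hli' := linearIndependent_comp_ofModel ((hli p ⟨hNM hp.1, hpV⟩).option hnot)
    refine contMDiffWithinAt_coefficients
      (a := fun o q => (Option.casesOn' o (η q) fun i => mvfderiv I (θ i) q).comp (ofModel I p q))
      (c := fun o q => Option.casesOn' o (c q) fun i => d q i) hp ?_ hβ hli' ?_ none
    · rintro (_ | i) v
      · exact (hη.1.contMDiffAt_ofModel p v).contMDiffWithinAt
      · exact ((hθ i).contMDiffAt_mvfderiv_ofModel hV hpV v).contMDiffWithinAt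
    · filter_upwards [self_mem_nhdsWithin, nhdsWithin_le_nhds (hV.mem_nhds hpV)] with q hq hqV v
      rw [hd q ⟨hq, hqV⟩, Fintype.sum_option]
      rfl
  refine contMDiffWithinAt_coefficients
    (a := fun s q => (mvfderiv I (ψ s) q).comp (ofModel I p q))
    (β := fun q v => hamiltonDefect η h q (X q) (ofModel I p q v) - c q * η q (ofModel I p q v))
    (c := fun s q => u q s) hp
    (fun s v => ((hN.smooth s).contMDiffAt_mvfderiv_ofModel hN.isOpen hp.2 v).contMDiffWithinAt)
    (fun v => (hβ v).sub (hcs.mul (hη.1.contMDiffAt_ofModel p v).contMDiffWithinAt))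
    (linearIndependent_comp_ofModel (hN.independent p hp)) ?_ s
  filter_upwards [self_mem_nhdsWithin] with q hq v
  rw [hu q hq, add_sub_cancel_left]
  rfl

/-! ### First class functions and the evolution of observables -/

variable {ι κ : Type*} [Fintype ι] [DecidableEq ι] [Fintype κ] {φ : ι → M → ℝ} {χ : κ → M → ℝ}

omit [FiniteDimensional ℝ E] [IsManifold I ∞ M] [I.Boundaryless] in
lemma djBracket_of_bracket_eq_zero (hf : ∀ a, bracket I η f (φ a) p = 0) (g : M → ℝ) :
    djBracket I η φ f g p = bracket I η f g p := by
  simp [djBracket, hf]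

lemma IsContactForm.djReebDeriv_of_bracket_eq_zero (hη : IsContactForm I η)
    (hC : IsUnit (bracketMatrix I η φ p).det) (hf : ∀ a, bracket I η f (φ a) p = 0) :
    djReebDeriv I η φ f p = reebDeriv I η f p := by
  simp [hη.djReebDeriv_eq hC, hf, pairing_apply]

/-- The second class multipliers of a motion preserving the second class constraints. -/
lemma IsContactForm.multipliers_eq (hη : IsContactForm I η)
    (hC : IsUnit (bracketMatrix I η φ p).det) (hφ : ∀ a, φ a p = 0)
    (hχ : ∀ b a, bracket I η (χ b) (φ a) p = 0) {v : TangentSpace I p} {u : ι → ℝ} {ubar : κ → ℝ}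
    (hv : v = hamField I η h p + ∑ a, u a • hamField I η (φ a) p
      + ∑ b, ubar b • hamField I η (χ b) p) (hv0 : ∀ a, mvfderiv I (φ a) p v = 0) (a : ι) :
    u a = -∑ b, bracket I η h (φ b) p * (bracketMatrix I η φ p)⁻¹ b a := by
  -- Applying `v` to `φ^b` gives `0 = {h, φ^b} + u_a C^{ab}`: the first class terms drop out, and so
  -- do all terms with a factor `φ^b(p) = 0`.
  have h1 : Matrix.vecMul u (bracketMatrix I η φ p) = -fun b => bracket I η h (φ b) p := by
    funext b
    have h2 := hv0 b
    rw [hv] at h2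
    simp only [map_add, map_sum, map_smul, hη.mvfderiv_hamField, hφ, hχ, zero_mul, sub_zero,
      smul_eq_mul, mul_zero, Finset.sum_const_zero, add_zero] at h2
    exact eq_neg_of_add_eq_zero_right h2
  have h3 : Matrix.vecMul (-fun b => bracket I η h (φ b) p) (bracketMatrix I η φ p)⁻¹ = u := by
    rw [← h1, Matrix.vecMul_vecMul, Matrix.mul_nonsing_inv _ hC, Matrix.vecMul_one]
  rw [Matrix.neg_vecMul] at h3
  exact (congrFun h3 a).symm

/-- The evolution of observables in terms of the Dirac-Jacobi bracket. -/
lemma IsContactForm.evolution_eq (hη : IsContactForm I η)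
    (hC : IsUnit (bracketMatrix I η φ p).det)
    (hχ : ∀ b a, bracket I η (χ b) (φ a) p = 0) {u : ι → ℝ} {ubar : κ → ℝ}
    (hu : ∀ a, u a = -∑ b, bracket I η h (φ b) p * (bracketMatrix I η φ p)⁻¹ b a) (f : M → ℝ) :
    mvfderiv I f p (hamField I η h p + ∑ a, u a • hamField I η (φ a) p
      + ∑ b, ubar b • hamField I η (χ b) p) =
    djBracket I η φ h f p - f p * djReebDeriv I η φ h p
      + ∑ b, ubar b * (djBracket I η φ (χ b) f p - f p * djReebDeriv I η φ (χ b) p) := by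
  have h1 (g : ι → ℝ) : ∑ a, u a * g a =
      -pairing (bracketMatrix I η φ p)⁻¹ (fun b => bracket I η h (φ b) p) g := by
    rw [pairing_apply, Finset.sum_comm]
    simp only [hu, neg_mul, Finset.sum_mul, Finset.sum_neg_distrib]
  simp only [map_add, map_sum, map_smul, hη.mvfderiv_hamField, smul_eq_mul,
    djBracket_of_bracket_eq_zero (hχ _), hη.djReebDeriv_of_bracket_eq_zero hC (hχ _)]
  -- The second class part of the motion supplies the corrections of both `{h, f}` and `R(h)`; the
  -- first class terms already agree with their Dirac-Jacobi versions.
  rw [h1, djBracket_eq, hη.djReebDeriv_eq hC, hη.inv_skew hC (fun a => reebDeriv I η (φ a) p)]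
  have h2 : (fun a => bracket I η (φ a) f p - f p * reebDeriv I η (φ a) p) =
      (fun a => bracket I η (φ a) f p) - f p • fun a => reebDeriv I η (φ a) p := rfl
  rw [h2, map_sub, map_smul, smul_eq_mul]
  ring

end Dynamics

end DiracJacobi

end

/-! ### The main theorem -/

theorem mainTheorem7
    {E : Type*} [NormedAddCommGroup E] [NormedSpace ℝ E] [FiniteDimensional ℝ E]
    {W : Type*} [TopologicalSpace W] (I : ModelWithCorners ℝ E W)
    {M : Type*} [TopologicalSpace M] [T2Space M] [ChartedSpace W M]
    [IsManifold I ∞ M] [I.Boundaryless]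
    -- the contact manifold
    (η : (p : M) → TangentSpace I p →L[ℝ] ℝ) (hη : DiracJacobi.IsContactForm I η)
    -- the primary constraint submanifold with its precontact Hamiltonian system
    (M₁ : Set M) (hM₁ : DiracJacobi.IsSubmanifold I M₁)
    (hpre : DiracJacobi.IsPrecontactOn I η M₁)
    (h₁ : M → ℝ) (hh₁ : ∀ p ∈ M₁, ContMDiffAt I 𝓘(ℝ, ℝ) ∞ h₁ p)
    -- the final constraint submanifold and independent constraints defining it on `U`
    (N : Set M) (hN : DiracJacobi.IsFinalConstraint I η M₁ h₁ N)
    (U : Set M) (hU : IsOpen U)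
    {ι κ : Type*} [Fintype ι] [DecidableEq ι] [Fintype κ]
    (φ : ι → M → ℝ) (χ : κ → M → ℝ)
    (hφ : ∀ a, DiracJacobi.SmoothOn I U (φ a)) (hχ : ∀ b, DiracJacobi.SmoothOn I U (χ b))
    (hzero : ∀ p ∈ U, p ∈ N ↔ (∀ a, φ a p = 0) ∧ ∀ b, χ b p = 0)
    (hindep : ∀ p ∈ N ∩ U, LinearIndependent ℝ (fun s : ι ⊕ κ => mvfderiv I (Sum.elim φ χ s) p))
    -- the `φ a` are the second class constraints, the `χ b` are first class
    (hC : ∀ p ∈ U, IsUnit (DiracJacobi.bracketMatrix I η φ p).det)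
    (hfirst : ∀ b, DiracJacobi.IsFirstClass I η (Sum.elim φ χ) N U (χ b)) :
    -- (1) Jacobi bracket with `E = -R_DJ`, and the generalized Leibniz rule
    DiracJacobi.IsJacobiBracketOn I U (DiracJacobi.djBracket I η φ)
      (fun p => -DiracJacobi.djReeb I η φ p) ∧
    (∀ f g h : M → ℝ, DiracJacobi.SmoothOn I U f → DiracJacobi.SmoothOn I U g →
      DiracJacobi.SmoothOn I U h → ∀ p ∈ U,
      DiracJacobi.djBracket I η φ (f * g) h p =
        f p * DiracJacobi.djBracket I η φ g h p + g p * DiracJacobi.djBracket I η φ f h p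
          + f p * g p * DiracJacobi.djReebDeriv I η φ h p) ∧
    -- (2) the second class constraints are Casimir functions
    (∀ a, ∀ g : M → ℝ, DiracJacobi.SmoothOn I U g → ∀ p ∈ U,
      DiracJacobi.djBracket I η φ (φ a) g p = 0) ∧
    -- (3) first class functions
    (∀ F : M → ℝ, DiracJacobi.SmoothOn I U F →
      DiracJacobi.IsFirstClass I η (Sum.elim φ χ) N U F →
      (∀ g : M → ℝ, DiracJacobi.SmoothOn I U g → ∀ p ∈ N ∩ U,
        DiracJacobi.djBracket I η φ F g p = DiracJacobi.bracket I η F g p) ∧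
      ∀ p ∈ N ∩ U, DiracJacobi.djReebDeriv I η φ F p = DiracJacobi.reebDeriv I η F p) ∧
    -- (4) the evolution of observables, for an arbitrary extension `h` of the Hamiltonian
    (∀ h : M → ℝ, DiracJacobi.SmoothOn I U h → (∀ p ∈ M₁ ∩ U, h p = h₁ p) →
      -- every motion is `X_h + u_a X_{φ^a} + ū_b X_{χ^b}` for some multipliers
      (∀ X : (p : M) → TangentSpace I p,
        (∀ p ∈ N ∩ U, X p ∈ DiracJacobi.tangentTo I N p ∧
          DiracJacobi.SolvesHamilton I η M₁ h₁ p (X p)) →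
        ∃ (u : ι → M → ℝ) (ubar : κ → M → ℝ),
          (∀ p ∈ N ∩ U, X p = DiracJacobi.hamField I η h p
            + ∑ a, u a p • DiracJacobi.hamField I η (φ a) p
            + ∑ b, ubar b p • DiracJacobi.hamField I η (χ b) p) ∧
          (DiracJacobi.SmoothFieldOn I (N ∩ U) X →
            (∀ a, DiracJacobi.SmoothOn I (N ∩ U) (u a)) ∧
            ∀ b, DiracJacobi.SmoothOn I (N ∩ U) (ubar b))) ∧
      -- along such a motion the evolution depends only on the first class multipliers
      (∀ p ∈ N ∩ U, ∀ v ∈ DiracJacobi.tangentTo I N p, ∀ (u : ι → ℝ) (ubar : κ → ℝ),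
        v = DiracJacobi.hamField I η h p
            + ∑ a, u a • DiracJacobi.hamField I η (φ a) p
            + ∑ b, ubar b • DiracJacobi.hamField I η (χ b) p →
        (∀ a, u a = -∑ b, DiracJacobi.bracket I η h (φ b) p *
            (DiracJacobi.bracketMatrix I η φ p)⁻¹ b a) ∧
        (∀ f : M → ℝ, DiracJacobi.SmoothOn I U f →
          mvfderiv I f p v =
            DiracJacobi.djBracket I η φ h f p - f p * DiracJacobi.djReebDeriv I η φ h p
            + ∑ b, ubar b * (DiracJacobi.djBracket I η φ (χ b) f p
              - f p * DiracJacobi.djReebDeriv I η φ (χ b) p)) ∧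
        (DiracJacobi.IsFirstClass I η (Sum.elim φ χ) N U h →
          v = DiracJacobi.hamField I η h p
            + ∑ b, ubar b • DiracJacobi.hamField I η (χ b) p))) := by
  have hcut : DiracJacobi.IsCutOut I (Sum.elim φ χ) N U :=
    ⟨hU, Sum.rec hφ hχ, fun q hq => by simp [hzero q hq, Sum.forall], hindep⟩
  -- The constraint algorithm enters through this inclusion: its sets only shrink.
  have hNM : N ⊆ M₁ := by
    obtain ⟨i, rfl, _⟩ := hN
    exact DiracJacobi.constraintSet_subset η M₁ h₁ i
  have hφ0 (p : M) (hp : p ∈ N ∩ U) : ∀ a, φ a p = 0 := ((hzero p hp.2).1 hp.1).1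
  refine ⟨DiracJacobi.isJacobiBracketOn_djBracket hη hU hφ hC, fun f g h hf hg _ p hp =>
    hη.djBracket_leibniz (hC p hp) (hf.mdifferentiableAt hU hp) (hg.mdifferentiableAt hU hp),
    fun a g _ p hp => DiracJacobi.djBracket_constraint (hC p hp) a g, fun F _ hF =>
    ⟨fun g _ p hp => DiracJacobi.djBracket_of_bracket_eq_zero (fun a => hF (Sum.inl a) p hp) g,
      fun p hp => hη.djReebDeriv_of_bracket_eq_zero (hC p hp.2) fun a => hF (Sum.inl a) p hp⟩,
    fun h hh hhh => ⟨fun X hX => ?_, fun p hp v hv u ubar huv => ?_⟩⟩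
  · obtain ⟨u, hu, hus⟩ := DiracJacobi.exists_multipliers hη hM₁ hh₁ hNM hcut hh hhh X hX
    refine ⟨fun a => u (Sum.inl a), fun b => u (Sum.inr b), fun p hp => ?_, fun hs =>
      ⟨fun a => hus hs _, fun b => hus hs _⟩⟩
    rw [hu p hp, Fintype.sum_sum_type, add_assoc]
    rfl
  · have hχ0 (b : κ) (a : ι) : DiracJacobi.bracket I η (χ b) (φ a) p = 0 :=
      hfirst b (Sum.inl a) p hp
    have hm := hη.multipliers_eq (hC p hp.2) (hφ0 p hp) hχ0 huv
      fun a => (hcut.mem_tangentTo_iff hp).1 hv (Sum.inl a)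
    refine ⟨hm, fun f _ => ?_, fun hF => ?_⟩
    · rw [huv]
      exact hη.evolution_eq (hC p hp.2) hχ0 hm f
    · have hu0 (a : ι) : u a = 0 := by
        have hF' (b : ι) : DiracJacobi.bracket I η h (φ b) p = 0 := hF (Sum.inl b) p hp
        simp [hm a, hF']
      rw [huv]
      simp [hu0]
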